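/- **Setting.** Let $c,R_{\mathrm e},H_a>0$, $H_s>H_a$, $\kappa_s>0$, $\lambda_u\ge 0$, $p_u^t\in[0,1]$, $\lambda_a^0>0$, $\check d\ge 0$, and for each hop $i\in\{1,2\}$ let $P_i,\iota_i,D_i,f_i,l_i,\Omega_i,\theta_i,\sigma_i>0$ and let $m_i\ge 1$ be an integer. Put $$p_a(\check d)=\frac{1-e^{-\lambda_a^0\pi\check d^2}}{\lambda_a^0\pi\check d^2}\ (\check d>0),\quad p_a(0)=1,\qquad \lambda_a=\lambda_a^0p_a(\check d),\qquad \lambda_1=p_u^t\lambda_u,\quad \lambda_2=\lambda_a .$$ The transmitters of hop $1$ (ground users) lie on the sphere of radius $R_{\mathrm e}$ about the origin, and the receiver (an aerial vehicle, AV) is at distance $R_{\mathrm e}+H_a$ from the origin. The transmitters of hop $2$ (AVs) lie on the sphere of radius $R_{\mathrm e}+H_a$, and the receiver (a satellite) is at distance $R_{\mathrm e}+H_s$ from the origin. The coverage region $\mathcal A_1$ is the spherical cap of height $H_1=1/(2\pi\lambda_aR_{\mathrm e})$ (that is, of area $1/\lambda_a$) centred below the AV, where $H_1\le 2R_{\mathrm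 e}$. The coverage region $\mathcal A_2$ is the set of points of the AV sphere that are on the near side of the satellite's horizon and are seen from the satellite within the angle $\vartheta_s$ of the downward vertical, where $\vartheta_s$ equals $c\kappa_s/(f_2D_2)$ degrees, $\vartheta_s<90^\circ$ and $(R_{\mathrm e}+H_s)\sin\vartheta_s\le R_{\mathrm e}+H_a$. (The conditions on $H_1$ and on $\vartheta_s$ are needed for hop $1$ and hop $2$ respectively.) Let $r_i(\mathtt t)$ be the distance from $\mathtt t$ to the receiver, $G_i=\iota_i(\pi D_if_i/c)^2$ and $L_i(\mathtt t)=l_i\left(\frac{c}{4\pi f_i}\right)^2r_i(\mathtt t)^{-2}$. A link from a transmitter $\mathtt t_0\in\mathcal A_i$ to the receiver has $$\mathtt{SINR}_i=\frac{P_iG_ih_iL_i(\mathtt t_0)}{I_i+\sigma_i^2},\qquad I_i=\sum_{\mathtt t\in\Phi_i'}P_iG_ih_{i,\mathtt t}L_i(\mathtt t),$$ where the set $\Phi_i'$ of interferers (the other transmitters) is a homogeneous Poisson point process on $\mathcal A_i$ with density $\lambda_i$ with respect to surface area (for $i=2$ this is the Poisson approximation of the Matérn hard-core process of the AVs), all channel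 power gains $h_i,h_{i,\mathtt t}$ are independent with the Gamma density $\frac{m_i^{m_i}}{\Gamma(m_i)\Omega_i^{m_i}}h^{m_i-1}e^{-m_ih/\Omega_i}$, $h>0$ (Nakagami-$m_i$ fading), and the location of $\mathtt t_0$, the process $\Phi_i'$ and the gains are mutually independent. **Proposition 1.** For each $i\in\{1,2\}$ and each location $\mathtt t_0\in\mathcal A_i$, writing $r_0=r_i(\mathtt t_0)$, the probability $\mathcal P_i=\mathbb P(\mathtt{SINR}_i>\theta_i)$ for the link from $\mathtt t_0$ is $$\mathcal P_i=\exp\left(-\dot S_i-\dot R_i\varepsilon_i\right)\sum_{k=0}^{m_i-1}\ \sum_{\substack{b_1,\dots,b_k\ge 0\\ b_1+2b_2+\cdots+kb_k=k}}\ \frac{\left(\dot S_i+\dot R_i\dot\varepsilon_i^{(1)}\right)^{b_1}\prod_{l=2}^{k}\left(\dot R_i\dot\varepsilon_i^{(l)}\right)^{b_l}}{b_1!\,b_2!\cdots b_k!},$$ (the inner sum is $1$ for $k=0$), where $$\dot S_i=\frac{16\,m_i\theta_i\sigma_i^2r_0^2}{\Omega_iP_i\iota_il_iD_i^2},\qquad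 \dot R_1=\frac{\pi\lambda_1R_{\mathrm e}}{R_{\mathrm e}+H_a},\qquad \dot R_2=\frac{\pi\lambda_2(R_{\mathrm e}+H_a)}{R_{\mathrm e}+H_s},$$ $$\varepsilon_i=\int_{\check R_i^2}^{\hat R_i^2}\left(1-\left(1+\frac{\theta_ir_0^2}{\gamma}\right)^{-m_i}\right)\mathrm d\gamma,\qquad \dot\varepsilon_i^{(l)}=\binom{m_i+l-1}{l}\int_{\check R_i^2}^{\hat R_i^2}\left(\frac{\theta_ir_0^2}{\gamma}\right)^{l}\left(1+\frac{\theta_ir_0^2}{\gamma}\right)^{-m_i-l}\mathrm d\gamma,$$ $$\check R_1=H_a,\quad \hat R_1=\sqrt{H_a^2+2H_1(R_{\mathrm e}+H_a)},\quad \check R_2=H_s-H_a,$$ $$\hat R_2=(R_{\mathrm e}+H_s)\cos\vartheta_s-\sqrt{(R_{\mathrm e}+H_a)^2-(R_{\mathrm e}+H_s)^2\sin^2\vartheta_s}.$$ Moreover, if the location of $\mathtt t_0$ in $\mathcal A_i$ is random, this expression, with $r_0=r_i(\mathtt t_0)$, is almost surely the conditional probability of $\{\mathtt{SINR}_i>\theta_i\}$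 given $\mathtt t_0$. -/

import Mathlib

open MeasureTheory ProbabilityTheory
open scoped Real

namespace GASS

/-- Three-dimensional Euclidean space; the Earth's centre is the origin. -/
abbrev Space : Type := EuclideanSpace ℝ (Fin 3)

/-- The two hops: ground user to aerial vehicle (AV), and AV to satellite. -/
inductive Hop : Type
  | first : Hop
  | second : Hop

/-- The system parameters, with their signs. -/
structure Params where
  /-- speed of light (in the units in use) -/
  c : ℝ
  /-- Earth radius -/
  Re : ℝ
  /-- altitude of the AVs above the ground -/
  Ha : ℝ
  /-- altitude of the satellite above the ground -/
  Hs : ℝ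
  /-- density of ground users -/
  lamU : ℝ
  /-- probability that a ground user transmits -/
  pT : ℝ
  /-- density of the Poisson process whose hard-core thinning gives the AVs -/
  lamA0 : ℝ
  /-- hard-core distance between AVs -/
  dMin : ℝ
  /-- beamwidth constant of the satellite antenna -/
  kappa : ℝ
  /-- transmission power -/
  P : Hop → ℝ
  /-- antenna illumination coefficient -/
  iota : Hop → ℝ
  /-- diameter of the receiving antenna -/
  D : Hop → ℝ
  /-- carrier frequency -/
  f : Hop → ℝ
  /-- additional (atmospheric) loss factor -/
  loss : Hop → ℝ
  /-- Nakagami shape parameter, an integer -/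
  m : Hop → ℕ
  /-- Nakagami spread parameter -/
  spread : Hop → ℝ
  /-- SINR threshold -/
  theta : Hop → ℝ
  /-- standard deviation of the noise, so that the noise power is its square -/
  sigma : Hop → ℝ
  c_pos : 0 < c
  Re_pos : 0 < Re
  Ha_pos : 0 < Ha
  Ha_lt_Hs : Ha < Hs
  lamU_nonneg : 0 ≤ lamU
  pT_nonneg : 0 ≤ pT
  pT_le_one : pT ≤ 1
  lamA0_pos : 0 < lamA0
  dMin_nonneg : 0 ≤ dMin
  kappa_pos : 0 < kappa
  P_pos : ∀ i, 0 < P i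
  iota_pos : ∀ i, 0 < iota i
  D_pos : ∀ i, 0 < D i
  f_pos : ∀ i, 0 < f i
  loss_pos : ∀ i, 0 < loss i
  m_pos : ∀ i, 1 ≤ m i
  spread_pos : ∀ i, 0 < spread i
  theta_pos : ∀ i, 0 < theta i
  sigma_pos : ∀ i, 0 < sigma i

noncomputable section

namespace Params

variable (S : Params)

/-! ### Densities and geometry -/

/-- Probability that a point survives the Matérn type II thinning. -/
def retain : ℝ :=
  if S.dMin = 0 then 1
  else (1 - Real.exp (-(S.lamA0 * π * S.dMin ^ 2))) / (S.lamA0 * π * S.dMin ^ 2)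

/-- Density of the AVs. -/
def lamA : ℝ := S.lamA0 * S.retain

/-- Density of the transmitters of each hop. -/
def density : Hop → ℝ
  | .first => S.pT * S.lamU
  | .second => S.lamA

/-- Radius of the sphere that carries the transmitters of each hop. -/
def txRadius : Hop → ℝ
  | .first => S.Re
  | .second => S.Re + S.Ha

/-- Distance of the receiver of each hop from the Earth's centre. -/
def rxRadius : Hop → ℝ
  | .first => S.Re + S.Ha
  | .second => S.Re + S.Hs

/-- Location of the receiver of each hop, in the direction of the unit vector `u`. -/
def receiver (i : Hop) (u : Space) : Space := S.rxRadius i • u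

/-- Height of the ground cap of area `1 / lamA` (the mean area of a Voronoi cell of the AVs). -/
def capHeight : ℝ := 1 / (2 * π * S.lamA * S.Re)

/-- Beam angle of the satellite; `c * kappa / (f * D)` is its value in degrees, and it is
converted to radians here. -/
def beam : ℝ := S.c * S.kappa / (S.f .second * S.D .second) * (π / 180)

/-- The coverage region of the receiver of each hop. For the first hop it is the ground cap of
height `capHeight` below the AV. For the second hop it is the set of points of the AV sphere that
are visible from the satellite (on the near side of its horizon) and that lie within the beam
angle of the vertical. -/
def coverage (i : Hop) (u : Space) : Set Space :=
  match i with
  | .first => {x | ‖x‖ = S.Re ∧ S.Re - S.capHeight ≤ inner ℝ x u}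
  | .second => {x | ‖x‖ = S.Re + S.Ha ∧
      (S.Re + S.Ha) ^ 2 ≤ (S.Re + S.Hs) * inner ℝ x u ∧
      InnerProductGeometry.angle (S.receiver .second u - x) u ≤ S.beam}

/-- The coverage region is a proper cap: the area `1 / lamA` does not exceed the area of the
Earth's surface, respectively the (acute) beam of the satellite meets the AV sphere along its whole
boundary. -/
def CapFits : Hop → Prop
  | .first => S.capHeight ≤ 2 * S.Re
  | .second => S.beam < π / 2 ∧ (S.Re + S.Hs) * Real.sin S.beam ≤ S.Re + S.Ha

/-- Surface area on the sphere of radius `R` about the origin, as a measure on space. -/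
def sphereArea (R : ℝ) : Measure Space :=
  ENNReal.ofReal (R ^ 2) •
    (volume : Measure Space).toSphere.map
      (fun x : Metric.sphere (0 : Space) 1 => R • (x : Space))

/-- Intensity measure of the transmitters: constant density on the coverage region. -/
def intensity (i : Hop) (u : Space) : Measure Space :=
  ENNReal.ofReal (S.density i) • (sphereArea (S.txRadius i)).restrict (S.coverage i u)

/-! ### Transmission -/

/-- Receiver antenna gain. -/
def gain (i : Hop) : ℝ := S.iota i * (π * S.D i * S.f i / S.c) ^ 2

/-- Path loss at distance `r`. -/
def pathLoss (i : Hop) (r : ℝ) : ℝ := S.loss i * (S.c / (4 * π * S.f i)) ^ 2 * (r ^ 2)⁻¹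

/-- Power received from a transmitter at `t` with channel power gain `h`. -/
def rxPower (i : Hop) (u t : Space) (h : ℝ) : ℝ :=
  S.P i * S.gain i * h * S.pathLoss i (dist t (S.receiver i u))

/-- SINR of the link from `t₀`, when the interferers are at `x 0, …, x (n - 1)`; `g 0` is the
channel power gain of the link and `g (k + 1)` that of the interferer at `x k`. -/
def sinr (i : Hop) (u t₀ : Space) (n : ℕ) (x : ℕ → Space) (g : ℕ → ℝ) : ℝ :=
  S.rxPower i u t₀ (g 0) /
    ((∑ k ∈ Finset.range n, S.rxPower i u (x k) (g (k + 1))) + S.sigma i ^ 2)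

/-! ### The closed form -/

/-- Minimal link distance. -/
def rMin : Hop → ℝ
  | .first => S.Ha
  | .second => S.Hs - S.Ha

/-- Maximal link distance. -/
def rMax : Hop → ℝ
  | .first => √(S.Ha ^ 2 + 2 * S.capHeight * (S.Re + S.Ha))
  | .second => (S.Re + S.Hs) * Real.cos S.beam -
      √((S.Re + S.Ha) ^ 2 - (S.Re + S.Hs) ^ 2 * Real.sin S.beam ^ 2)

/-- The noise term at link distance `r₀`. -/
def Sdot (i : Hop) (r₀ : ℝ) : ℝ :=
  16 * S.m i * S.theta i * S.sigma i ^ 2 * r₀ ^ 2 /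
    (S.spread i * S.P i * S.iota i * S.loss i * S.D i ^ 2)

/-- The density factor. -/
def Rdot : Hop → ℝ
  | .first => π * S.density .first * S.Re / (S.Re + S.Ha)
  | .second => π * S.density .second * (S.Re + S.Ha) / (S.Re + S.Hs)

/-- The integral in the exponent. -/
def eps (i : Hop) (r₀ : ℝ) : ℝ :=
  ∫ y in (S.rMin i ^ 2)..(S.rMax i ^ 2), (1 - ((1 + S.theta i * r₀ ^ 2 / y) ^ S.m i)⁻¹)

/-- The integral of order `l`. -/
def epsD (i : Hop) (r₀ : ℝ) (l : ℕ) : ℝ :=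
  ((S.m i + l - 1).choose l : ℝ) *
    ∫ y in (S.rMin i ^ 2)..(S.rMax i ^ 2),
      (S.theta i * r₀ ^ 2 / y) ^ l * ((1 + S.theta i * r₀ ^ 2 / y) ^ (S.m i + l))⁻¹

/-- The base of the `l`-th power: the noise term enters for `l = 1` only. -/
def base (i : Hop) (r₀ : ℝ) (l : ℕ) : ℝ :=
  (if l = 1 then S.Sdot i r₀ else 0) + S.Rdot i * S.epsD i r₀ l

/-- The success probability at link distance `r₀`. The inner sum is over all natural numbers
`b 0, …, b (k - 1)` with `∑ j, (j + 1) * b j = k` (each of them is at most `k`). -/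
def successProb (i : Hop) (r₀ : ℝ) : ℝ :=
  Real.exp (-S.Sdot i r₀ - S.Rdot i * S.eps i r₀) *
    ∑ k ∈ Finset.range (S.m i),
      ∑ b : Fin k → Fin (k + 1) with ∑ j : Fin k, ((j : ℕ) + 1) * (b j : ℕ) = k,
        ∏ j : Fin k, S.base i r₀ ((j : ℕ) + 1) ^ (b j : ℕ) / ((b j : ℕ).factorial : ℝ)

end Params

/-! ### The random model -/

open Classical in
/-- The number of points in `B` of the finite point process `x 0, …, x (n - 1)`. -/
def count (n : ℕ) (x : ℕ → Space) (B : Set Space) : ℕ :=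
  ((Finset.range n).filter (fun k => x k ∈ B)).card

/-- `X 0, …, X (N - 1)` is a measurable enumeration of a Poisson point process with the finite
intensity measure `Λ`: the number of points in a measurable set is Poisson distributed, and the
numbers of points in pairwise disjoint measurable sets are independent. -/
structure IsPoissonProcess {Ω : Type*} [MeasurableSpace Ω] (μ : Measure Ω)
    (Λ : Measure Space) (N : Ω → ℕ) (X : ℕ → Ω → Space) : Prop where
  measurable_card : Measurable N
  measurable_point : ∀ n, Measurable (X n)
  law_count : ∀ B : Set Space, MeasurableSet B →
    μ.map (fun ω => count (N ω) (fun n => X n ω) B) = poissonMeasure (Λ B).toNNReal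
  indep_count : ∀ (k : ℕ) (B : Fin k → Set Space), (∀ j, MeasurableSet (B j)) →
    Pairwise (fun j j' => Disjoint (B j) (B j')) →
    iIndepFun (fun (j : Fin k) ω => count (N ω) (fun n => X n ω) (B j)) μ

/-- The random model of a link of hop `i` whose receiver lies in the direction `u`: the location
`T` of its transmitter lies in the coverage region, the interferers (the other transmitters) are a
homogeneous Poisson process on the coverage region, all channel power gains `g` are independent and
Gamma distributed with shape `m` and rate `m / spread` (Nakagami fading), and the transmitter
location, the interferer locations and the channel gains are mutually independent. -/
structure IsLinkModel (S : Params) (i : Hop) (u : Space) {Ω : Type*} [MeasurableSpace Ω]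
    (μ : Measure Ω) (T : Ω → Space) (N : Ω → ℕ) (X : ℕ → Ω → Space) (g : ℕ → Ω → ℝ) :
    Prop where
  measurable_tx : Measurable T
  tx_mem : ∀ᵐ ω ∂μ, T ω ∈ S.coverage i u
  poisson : IsPoissonProcess μ (S.intensity i u) N X
  measurable_gain : ∀ n, Measurable (g n)
  law_gain : ∀ n, μ.map (g n) = gammaMeasure (S.m i) (S.m i / S.spread i)
  indep_gain : iIndepFun g μ
  indep_location : IndepFun T (fun ω => (N ω, fun n => X n ω)) μ
  indep_fading : IndepFun (fun ω => (T ω, N ω, fun n => X n ω)) (fun ω n => g n ω) μ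

end

end GASS

namespace GASS

/-! ### Archimedes' theorem for the unit sphere of three-dimensional space. -/

section


open Set ENNReal

/-! After normalization, the SINR exceeds the threshold exactly when `m / spread` times the gain of
the link exceeds a random level `Y`, the rescaled interference plus the noise term `Sdot`
(`theta_lt_sinr_iff`). The gain is Gamma of integer shape and independent of `Y`, so its tail is a
Poisson sum, and the probability is the sum over `k < m` of `p k = E[exp(-Y) Y^k / k!]`
(`measureReal_lt_gamma`).

The numbers `p k` have the generating function `∑ p k * w^k = E[exp(-(1 - w) Y)]` on `[0, 1]`, the
Laplace transform of `Y` at `1 - w`. It is computed in `integral_exp_neg_level`: averaging over the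
fading gives a product over the interferers, the generating functional of the Poisson process
(`IsPoissonProcess.integral_prod`) turns it into the exponential of an integral over the coverage
region, and Archimedes' theorem makes the squared distance to the receiver uniform
(`map_intensity`), which leaves a one-dimensional integral.

The negative binomial series expands this integral in powers of `w` (`hasSum_base`), so that the
generating function is a constant times `exp (∑ base l * w^l)`, `l ≥ 1`. Comparing coefficients
(`exp_series_coeff`) gives the sum over partitions of `k`. The conditional statement follows because
the transmitter location is independent of everything else and can be frozen. -/

theorem lintegral_eq_lintegral_coords {u : Space} (hu : ‖u‖ = 1) {G : ℝ → ℝ → ℝ≥0∞}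
    (hG : Measurable (Function.uncurry G)) :
    ∫⁻ y : Space, G (inner ℝ y u) ‖y‖ =
      ∫⁻ z : ℝ, ∫⁻ w : ℝ × ℝ, G z √(z ^ 2 + (w.1 ^ 2 + w.2 ^ 2)) := by
  -- Coordinates in an orthonormal basis that starts with `u` preserve volume; the coordinate along
  -- `u` is the inner product.
  obtain ⟨b, hb⟩ : ∃ b : OrthonormalBasis (Fin 3) ℝ Space, b 0 = u := by
    obtain ⟨b, hb⟩ := Orthonormal.exists_orthonormalBasis_extension_of_card_eq (𝕜 := ℝ)
      (E := Space) (ι := Fin 3) (by simp) (v := fun _ => u) (s := {0})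
      (by
        rw [orthonormal_iff_ite]
        rintro ⟨i, hi⟩ ⟨j, hj⟩
        have hi' : i = 0 := hi
        have hj' : j = 0 := hj
        subst hi' hj'
        simp [Set.domRestrict, hu])
    exact ⟨b, hb 0 rfl⟩
  have h1 := b.measurePreserving_repr
  have h2 := PiLp.volume_preserving_ofLp (Fin 3)
  have h3 := volume_preserving_piFinSuccAbove (fun _ : Fin 3 => ℝ) 0
  have h4 : MeasurePreserving
      (Prod.map id MeasurableEquiv.finTwoArrow : ℝ × (Fin 2 → ℝ) → ℝ × ℝ × ℝ)
      volume volume :=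
    (MeasurePreserving.id volume).prod (volume_preserving_finTwoArrow ℝ)
  have h := h4.comp (h3.comp (h2.comp h1))
  have hF : Measurable fun p : ℝ × ℝ × ℝ => G p.1 √(p.1 ^ 2 + (p.2.1 ^ 2 + p.2.2 ^ 2)) :=
    hG.comp (measurable_fst.prodMk (by fun_prop))
  have key := h.lintegral_comp hF
  rw [Measure.volume_eq_prod, lintegral_prod _ hF.aemeasurable] at key
  rw [← key]
  refine lintegral_congr fun y => ?_
  have e0 : inner ℝ y u = b.repr y 0 := by
    rw [b.repr_apply_apply, hb, real_inner_comm]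
  have e1 : ‖y‖ = √(b.repr y 0 ^ 2 + (b.repr y 1 ^ 2 + b.repr y 2 ^ 2)) := by
    rw [← b.repr.norm_map y, EuclideanSpace.norm_eq, Fin.sum_univ_three]
    simp [add_assoc]
  rw [e0, e1]
  rfl

/-- Polar coordinates in the plane, then `r = √(z² + ρ²)`, for which `r dr = ρ dρ`. -/
theorem lintegral_radial_plane {z : ℝ} {g : ℝ → ℝ≥0∞} (hg : Measurable g) :
    ∫⁻ w : ℝ × ℝ, g √(z ^ 2 + (w.1 ^ 2 + w.2 ^ 2)) =
      ENNReal.ofReal (2 * π) * ∫⁻ r in Ioi |z|, ENNReal.ofReal r * g r := by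
  have himg : (fun ρ : ℝ => √(z ^ 2 + ρ ^ 2)) '' Ioi 0 = Ioi |z| := by
    ext r
    simp only [mem_image, mem_Ioi]
    constructor
    · rintro ⟨ρ, hρ, rfl⟩
      rw [← Real.sqrt_sq_eq_abs]
      exact Real.sqrt_lt_sqrt (by positivity) (by nlinarith)
    · intro hr
      have hr0 : 0 < r := (abs_nonneg z).trans_lt hr
      have hlt : z ^ 2 < r ^ 2 := by
        rw [← sq_abs z]; exact pow_lt_pow_left₀ hr (abs_nonneg z) two_ne_zero
      refine ⟨√(r ^ 2 - z ^ 2), Real.sqrt_pos.2 (by linarith), ?_⟩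
      rw [Real.sq_sqrt (by linarith), add_sub_cancel, Real.sqrt_sq hr0.le]
  rw [← lintegral_comp_polarCoord_symm, ← himg,
    lintegral_image_eq_lintegral_abs_deriv_mul measurableSet_Ioi
      (f' := fun ρ => ρ / √(z ^ 2 + ρ ^ 2))]
  · have e : ∀ p ∈ polarCoord.target, ENNReal.ofReal p.1 •
        g √(z ^ 2 + ((polarCoord.symm p).1 ^ 2 + (polarCoord.symm p).2 ^ 2)) =
        ENNReal.ofReal p.1 * g √(z ^ 2 + p.1 ^ 2) := by
      intro p _
      have : (p.1 * Real.cos p.2) ^ 2 + (p.1 * Real.sin p.2) ^ 2 = p.1 ^ 2 := by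
        linear_combination p.1 ^ 2 * Real.sin_sq_add_cos_sq p.2
      simp only [polarCoord_symm_apply, this, smul_eq_mul]
    rw [setLIntegral_congr_fun polarCoord.open_target.measurableSet e, polarCoord_target,
      Measure.volume_eq_prod, ← Measure.prod_restrict]
    have e2 : ∀ ρ ∈ Ioi (0 : ℝ), ENNReal.ofReal |ρ / √(z ^ 2 + ρ ^ 2)| *
        (ENNReal.ofReal √(z ^ 2 + ρ ^ 2) * g √(z ^ 2 + ρ ^ 2)) =
        ENNReal.ofReal ρ * g √(z ^ 2 + ρ ^ 2) := by
      intro ρ hρ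
      have hρ' : 0 < ρ := hρ
      have hs : 0 < √(z ^ 2 + ρ ^ 2) := Real.sqrt_pos.2 (by positivity)
      rw [← mul_assoc, ← ENNReal.ofReal_mul (abs_nonneg _), abs_of_pos (by positivity),
        div_mul_cancel₀ _ hs.ne']
    rw [setLIntegral_congr_fun measurableSet_Ioi e2]
    have := lintegral_prod_mul (μ := volume.restrict (Ioi (0 : ℝ)))
      (ν := volume.restrict (Ioo (-π) π)) (f := fun ρ => ENNReal.ofReal ρ * g √(z ^ 2 + ρ ^ 2))
      (g := fun _ => 1) (by fun_prop) (by fun_prop)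
    simp only [mul_one] at this
    rw [this, mul_comm]
    congr 1
    simp [two_mul]
  · intro ρ hρ
    have hρ' : 0 < ρ := hρ
    have : HasDerivAt (fun ρ : ℝ => z ^ 2 + ρ ^ 2) (2 * ρ) ρ := by
      simpa using (hasDerivAt_pow 2 ρ).const_add (z ^ 2)
    have := (this.sqrt (by positivity)).hasDerivWithinAt (s := Ioi 0)
    rwa [mul_div_mul_left _ _ two_ne_zero] at this
  · intro a ha b hb hab
    have ha' : 0 < a := ha
    have hb' : 0 < b := hb
    have := (Real.sqrt_inj (by positivity) (by positivity)).1 hab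
    nlinarith


theorem lintegral_comp_div {r : ℝ} (hr : 0 < r) (h : ℝ → ℝ≥0∞) :
    ∫⁻ z : ℝ, h (z / r) = ENNReal.ofReal r * ∫⁻ t, h t := by
  have himg : (fun t : ℝ => r * t) '' univ = univ :=
    image_univ_of_surjective (mul_left_surjective₀ hr.ne')
  have := lintegral_image_eq_lintegral_abs_deriv_mul (s := univ) (f := fun t : ℝ => r * t)
    (f' := fun _ => r) MeasurableSet.univ
    (fun x _ => by simpa using ((hasDerivAt_id' x).const_mul r).hasDerivWithinAt (s := univ))
    (mul_right_injective₀ hr.ne').injOn (fun z => h (z / r))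
  rw [himg, setLIntegral_univ, setLIntegral_univ] at this
  rw [this, ← lintegral_const_mul' _ _ ENNReal.ofReal_ne_top]
  simp [abs_of_pos hr, mul_div_cancel_left₀ _ hr.ne']

/-- The function `h (⟪y, u⟫ / ‖y‖)` is integrated over the unit ball in two ways. Spherical
coordinates give the integral over the sphere times `1/3`. Slicing orthogonally to `u` and
substituting `z = r t` gives `2π ∫ h`, again times `∫₀¹ r² dr = 1/3`. The support condition frees
the inner integral from the constraint `|z| < r`. -/
theorem lintegral_toSphere_inner_of_support {u : Space} (hu : ‖u‖ = 1) {h : ℝ → ℝ≥0∞}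
    (hh : Measurable h) (hsupp : ∀ t, t ∉ Icc (-1 : ℝ) 1 → h t = 0) :
    ∫⁻ x : Metric.sphere (0 : Space) 1, h (inner ℝ (x : Space) u)
        ∂(volume : Measure Space).toSphere =
      ENNReal.ofReal (2 * π) * ∫⁻ t, h t := by
  have hG : Measurable (Function.uncurry fun z r : ℝ => h (z / r) * (Iio (1 : ℝ)).indicator 1 r) :=
    (hh.comp (measurable_fst.div measurable_snd)).mul
      ((measurable_one.indicator measurableSet_Iio).comp measurable_snd)
  have hsph : ∫⁻ y : Space, h (inner ℝ y u / ‖y‖) * (Iio (1 : ℝ)).indicator 1 ‖y‖ =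
      (∫⁻ x : Metric.sphere (0 : Space) 1, h (inner ℝ (x : Space) u)
        ∂(volume : Measure Space).toSphere) * ENNReal.ofReal (1 / 3) := by
    have hmp := (volume : Measure Space).measurePreserving_homeomorphUnitSphereProd
    conv_lhs => rw [← restrict_compl_singleton (μ := (volume : Measure Space)) 0]
    rw [← lintegral_subtype_comap (measurableSet_singleton _).compl]
    have e : ∀ y : ({(0 : Space)}ᶜ : Set Space),
        h (inner ℝ (y : Space) u / ‖(y : Space)‖) * (Iio (1 : ℝ)).indicator 1 ‖(y : Space)‖ =
        (fun p : Metric.sphere (0 : Space) 1 × Ioi (0 : ℝ) =>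
          h (inner ℝ (p.1 : Space) u) * (Iio (1 : ℝ)).indicator 1 (p.2 : ℝ))
          (homeomorphUnitSphereProd Space y) := by
      intro y
      simp only [homeomorphUnitSphereProd_apply_snd_coe, homeomorphUnitSphereProd_apply_fst_coe,
        real_inner_smul_left, div_eq_inv_mul]
    simp_rw [e]
    rw [hmp.lintegral_comp_emb (Homeomorph.measurableEmbedding _)
        (fun p : Metric.sphere (0 : Space) 1 × Ioi (0 : ℝ) =>
          h (inner ℝ (p.1 : Space) u) * (Iio (1 : ℝ)).indicator 1 (p.2 : ℝ)),
      lintegral_prod_mul (f := fun x : Metric.sphere (0 : Space) 1 => h (inner ℝ (x : Space) u))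
        (g := fun r : Ioi (0 : ℝ) => (Iio (1 : ℝ)).indicator 1 (r : ℝ)) (by fun_prop)
        (by exact ((measurable_one.indicator measurableSet_Iio).comp
              measurable_subtype_coe).aemeasurable)]
    congr 1
    have e2 : (fun r : Ioi (0 : ℝ) => (Iio (1 : ℝ)).indicator (1 : ℝ → ℝ≥0∞) (r : ℝ)) =
        (Iio (⟨1, mem_Ioi.2 one_pos⟩ : Ioi (0 : ℝ))).indicator 1 := by
      ext r
      rfl
    rw [e2, lintegral_indicator_one measurableSet_Iio, Measure.volumeIoiPow_apply_Iio]
    norm_num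
  have hcyl : ∫⁻ y : Space, h (inner ℝ y u / ‖y‖) * (Iio (1 : ℝ)).indicator 1 ‖y‖ =
      ENNReal.ofReal (2 * π) * (∫⁻ t, h t) * ENNReal.ofReal (1 / 3) := by
    rw [lintegral_eq_lintegral_coords hu hG]
    have e : ∀ z : ℝ, ∫⁻ w : ℝ × ℝ, h (z / √(z ^ 2 + (w.1 ^ 2 + w.2 ^ 2))) *
        (Iio (1 : ℝ)).indicator 1 √(z ^ 2 + (w.1 ^ 2 + w.2 ^ 2)) =
        ENNReal.ofReal (2 * π) * ∫⁻ r in Ioo 0 1, ENNReal.ofReal r * h (z / r) := by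
      intro z
      rw [lintegral_radial_plane (g := fun r => h (z / r) * (Iio (1 : ℝ)).indicator 1 r)
        (hG.comp measurable_prodMk_left)]
      congr 1
      -- The ray is closed first because `r = |z|` gives a ratio `±1`, where `h` need not vanish;
      -- for `0 < r < |z|` the ratio is outside `[-1, 1]`.
      rw [Measure.restrict_congr_set Ioi_ae_eq_Ici,
        ← lintegral_indicator measurableSet_Ici, ← lintegral_indicator measurableSet_Ioo]
      refine lintegral_congr fun r => ?_
      simp only [indicator, mem_Ici, mem_Ioo, mem_Iio, Pi.one_apply]
      rcases le_or_gt r 0 with h0 | h0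
      · simp [h0.not_gt, ENNReal.ofReal_of_nonpos h0]
      by_cases h1 : r < 1 <;> by_cases hz : |z| ≤ r <;> simp [h1, h0, hz]
      refine Or.inr (hsupp _ ?_)
      rw [mem_Icc, ← abs_le, abs_div, abs_of_pos h0, div_le_one h0]
      exact hz
    simp_rw [e]
    have hm : Measurable (Function.uncurry fun z r : ℝ => ENNReal.ofReal r * h (z / r)) :=
      (measurable_snd.ennreal_ofReal).mul (hh.comp (measurable_fst.div measurable_snd))
    rw [lintegral_const_mul' _ _ ENNReal.ofReal_ne_top, mul_assoc,
      lintegral_lintegral_swap hm.aemeasurable]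
    congr 1
    have e3 : ∀ r ∈ Ioo (0 : ℝ) 1, ∫⁻ z : ℝ, ENNReal.ofReal r * h (z / r) =
        ENNReal.ofReal (r ^ 2) * ∫⁻ t, h t := by
      intro r hr
      rw [lintegral_const_mul' _ _ ENNReal.ofReal_ne_top, lintegral_comp_div hr.1, ← mul_assoc,
        ← ENNReal.ofReal_mul hr.1.le, sq]
    rw [setLIntegral_congr_fun measurableSet_Ioo e3, lintegral_mul_const _ (by fun_prop), mul_comm]
    congr 1
    rw [Measure.restrict_congr_set Ioo_ae_eq_Ioc, ← ofReal_integral_eq_lintegral_ofReal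
      (intervalIntegral.intervalIntegrable_pow 2).1, ← intervalIntegral.integral_of_le zero_le_one]
    · norm_num
    · exact ae_of_all _ fun r => by positivity
  rw [hsph] at hcyl
  exact (ENNReal.mul_left_inj (by norm_num) ENNReal.ofReal_ne_top).1 hcyl

/-- Archimedes' theorem: the surface area of the unit sphere is uniformly distributed along any
axis. -/
theorem lintegral_toSphere_inner {u : Space} (hu : ‖u‖ = 1) {f : ℝ → ℝ≥0∞} (hf : Measurable f) :
    ∫⁻ x : Metric.sphere (0 : Space) 1, f (inner ℝ (x : Space) u)
        ∂(volume : Measure Space).toSphere =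
      ENNReal.ofReal (2 * π) * ∫⁻ t in Icc (-1 : ℝ) 1, f t := by
  have h := lintegral_toSphere_inner_of_support hu (hf.indicator measurableSet_Icc)
    (fun t ht => indicator_of_notMem ht f)
  rw [lintegral_indicator measurableSet_Icc] at h
  rw [← h]
  refine lintegral_congr fun x => (indicator_of_mem ?_ f).symm
  have hx : ‖(x : Space)‖ = 1 := by simp
  have := abs_real_inner_le_norm (x : Space) u
  rw [hx, hu, one_mul] at this
  exact abs_le.1 this

end

/-! ### Spherical area, the coverage regions, and the law of the link distance. -/

section


open Set ENNReal

theorem lintegral_sphereArea {R : ℝ} {F : Space → ℝ≥0∞} (hF : Measurable F) :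
    ∫⁻ x, F x ∂(Params.sphereArea R) = ENNReal.ofReal (R ^ 2) *
      ∫⁻ x : Metric.sphere (0 : Space) 1, F (R • (x : Space)) ∂(volume : Measure Space).toSphere := by
  rw [Params.sphereArea, lintegral_smul_measure, lintegral_map hF (by fun_prop), smul_eq_mul]

instance (R : ℝ) : IsFiniteMeasure (Params.sphereArea R) := by
  unfold Params.sphereArea
  have : IsFiniteMeasure ((volume : Measure Space).toSphere.map
      (fun x : Metric.sphere (0 : Space) 1 => R • (x : Space))) := inferInstance
  exact Measure.smul_finite _ ENNReal.ofReal_ne_top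

theorem ae_norm_sphereArea {R : ℝ} (hR : 0 ≤ R) : ∀ᵐ x ∂(Params.sphereArea R), ‖x‖ = R := by
  unfold Params.sphereArea
  refine Measure.ae_smul_measure ?_ _
  rw [ae_map_iff (by fun_prop) (measurableSet_eq_fun measurable_norm measurable_const)]
  refine ae_of_all _ fun x => ?_
  rw [norm_smul, Real.norm_of_nonneg hR]
  simp

theorem dist_smul_sq {u x : Space} (hu : ‖u‖ = 1) (D : ℝ) :
    dist x (D • u) ^ 2 = ‖x‖ ^ 2 + D ^ 2 - 2 * D * inner ℝ x u := by
  rw [dist_eq_norm, norm_sub_sq_real, norm_smul, hu, real_inner_smul_right, Real.norm_eq_abs,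
    mul_one, sq_abs]
  ring

/-- The squared distance of a uniform point of a sphere to a fixed point is uniformly
distributed. -/
theorem lintegral_sphereArea_dist_sq {u : Space} (hu : ‖u‖ = 1) {R D : ℝ} (hR : 0 < R)
    (hD : 0 < D) {F : ℝ → ℝ≥0∞} (hF : Measurable F) :
    ∫⁻ x, F (dist x (D • u) ^ 2) ∂(Params.sphereArea R) =
      ENNReal.ofReal (π * R / D) * ∫⁻ y in Icc ((D - R) ^ 2) ((D + R) ^ 2), F y := by
  rw [lintegral_sphereArea (F := fun x => F (dist x (D • u) ^ 2)) (by fun_prop)]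
  have hRD : 0 < 2 * D * R := by positivity
  have e : ∀ x : Metric.sphere (0 : Space) 1, F (dist (R • (x : Space)) (D • u) ^ 2) =
      (fun t => F (R ^ 2 + D ^ 2 - 2 * D * R * t)) (inner ℝ (x : Space) u) := by
    intro x
    rw [dist_smul_sq hu, norm_smul, Real.norm_of_nonneg hR.le, real_inner_smul_left]
    have : ‖(x : Space)‖ = 1 := by simp
    simp only [this, mul_one, mul_assoc]
  simp_rw [e]
  rw [lintegral_toSphere_inner hu (f := fun t => F (R ^ 2 + D ^ 2 - 2 * D * R * t)) (by fun_prop)]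
  -- By the law of cosines the squared distance is affine in the height `t` with slope `-2DR`, which
  -- accounts for the factor `2πR² / (2DR) = πR / D`.
  have himg : (fun t : ℝ => R ^ 2 + D ^ 2 - 2 * D * R * t) '' Icc (-1) 1 =
      Icc ((D - R) ^ 2) ((D + R) ^ 2) := by
    ext y
    simp only [mem_image, mem_Icc]
    constructor
    · rintro ⟨t, ⟨h1, h2⟩, rfl⟩
      constructor <;> nlinarith
    · rintro ⟨h1, h2⟩
      refine ⟨(R ^ 2 + D ^ 2 - y) / (2 * D * R), ⟨?_, ?_⟩, by field_simp; ring⟩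
      · rw [le_div_iff₀ hRD]; nlinarith
      · rw [div_le_iff₀ hRD]; nlinarith
  have := lintegral_image_eq_lintegral_abs_deriv_mul (s := Icc (-1 : ℝ) 1)
    (f := fun t : ℝ => R ^ 2 + D ^ 2 - 2 * D * R * t)
    (f' := fun _ => -(2 * D * R)) measurableSet_Icc
    (fun x _ => by
      have := ((hasDerivAt_id' x).const_mul (2 * D * R)).const_sub (R ^ 2 + D ^ 2)
      rw [mul_one] at this
      exact this.hasDerivWithinAt)
    (fun a _ b _ hab => mul_left_cancel₀ hRD.ne' (by simpa using hab)) F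
  rw [himg] at this
  rw [this, lintegral_const_mul _ (by fun_prop), abs_neg, abs_of_pos hRD, ← mul_assoc, ← mul_assoc,
    ← ENNReal.ofReal_mul (by positivity), ← ENNReal.ofReal_mul (by positivity)]
  congr 2
  field_simp

namespace Params

variable (S : Params)

theorem retain_pos : 0 < S.retain := by
  unfold retain
  split_ifs with h
  · exact one_pos
  · have : 0 < S.lamA0 * π * S.dMin ^ 2 :=
      mul_pos (mul_pos S.lamA0_pos Real.pi_pos) (by positivity)
    refine div_pos ?_ this
    rw [sub_pos, Real.exp_lt_one_iff]
    linarith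

theorem lamA_pos : 0 < S.lamA := mul_pos S.lamA0_pos S.retain_pos

theorem density_nonneg (i : Hop) : 0 ≤ S.density i := by
  cases i
  · exact mul_nonneg S.pT_nonneg S.lamU_nonneg
  · exact S.lamA_pos.le

theorem capHeight_pos : 0 < S.capHeight := by
  have := S.lamA_pos
  have := S.Re_pos
  unfold capHeight
  positivity

theorem beam_pos : 0 < S.beam := by
  have := S.c_pos
  have := S.kappa_pos
  have := S.f_pos .second
  have := S.D_pos .second
  unfold beam
  positivity

theorem txRadius_pos (i : Hop) : 0 < S.txRadius i := by
  have := S.Re_pos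
  have := S.Ha_pos
  cases i <;> simp only [txRadius] <;> linarith

theorem rxRadius_sub_txRadius (i : Hop) : S.rxRadius i - S.txRadius i = S.rMin i := by
  cases i <;> simp only [txRadius, rxRadius, rMin] <;> ring

theorem rMin_pos (i : Hop) : 0 < S.rMin i := by
  have := S.Ha_pos
  have := S.Ha_lt_Hs
  cases i <;> simp only [rMin] <;> linarith

theorem txRadius_lt_rxRadius (i : Hop) : S.txRadius i < S.rxRadius i := by
  have := S.rxRadius_sub_txRadius i
  have := S.rMin_pos i
  linarith

theorem rxRadius_pos (i : Hop) : 0 < S.rxRadius i :=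
  (S.txRadius_pos i).trans (S.txRadius_lt_rxRadius i)

theorem Rdot_eq (i : Hop) :
    S.Rdot i = S.density i * (π * S.txRadius i / S.rxRadius i) := by
  cases i <;> simp only [Rdot, txRadius, rxRadius] <;> ring

theorem Rdot_nonneg (i : Hop) : 0 ≤ S.Rdot i := by
  have := S.density_nonneg i
  have := S.txRadius_pos i
  have := S.rxRadius_pos i
  rw [Rdot_eq]
  positivity

theorem norm_of_mem_coverage {i : Hop} {u x : Space} (hx : x ∈ S.coverage i u) :
    ‖x‖ = S.txRadius i := by
  cases i <;> exact hx.1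

theorem rMin_le_dist {i : Hop} {u x : Space} (hu : ‖u‖ = 1) (hx : x ∈ S.coverage i u) :
    S.rMin i ≤ dist x (S.receiver i u) := by
  have h := norm_sub_norm_le (S.receiver i u) x
  rw [S.norm_of_mem_coverage hx, receiver, norm_smul, hu, mul_one,
    Real.norm_of_nonneg (S.rxRadius_pos i).le, S.rxRadius_sub_txRadius] at h
  rwa [dist_comm, dist_eq_norm]

/-- Properties of the maximal link distance: it is the smaller root of the quadratic equation
that describes the boundary of the beam. -/
theorem rMax_second (hcap : S.CapFits .second) :
    S.rMin .second ≤ S.rMax .second ∧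
    S.rMax .second ^ 2 ≤ (S.rxRadius .second + S.txRadius .second) ^ 2 ∧
    ∀ r, 0 < r → (r ≤ S.rMax .second ↔
      r ^ 2 ≤ S.rxRadius .second ^ 2 - S.txRadius .second ^ 2 ∧
      2 * S.rxRadius .second * r * Real.cos S.beam ≤
        S.rxRadius .second ^ 2 - S.txRadius .second ^ 2 + r ^ 2) := by
  have hR := S.txRadius_pos .second
  have hRD := S.txRadius_lt_rxRadius .second
  have hmin := S.rxRadius_sub_txRadius .second
  rw [← hmin]
  have hmax : S.rMax .second = S.rxRadius .second * Real.cos S.beam -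
      √(S.txRadius .second ^ 2 - S.rxRadius .second ^ 2 * Real.sin S.beam ^ 2) := rfl
  have hc1 : S.rxRadius .second * Real.sin S.beam ≤ S.txRadius .second := hcap.2
  have hc0 := hcap.1
  have hb := S.beam_pos
  have hsin : 0 < Real.sin S.beam :=
    Real.sin_pos_of_pos_of_lt_pi hb (by linarith [Real.pi_pos])
  have hcos : 0 < Real.cos S.beam := Real.cos_pos_of_mem_Ioo ⟨by linarith, hc0⟩
  have hsc := Real.sin_sq_add_cos_sq S.beam
  have hcos1 := Real.cos_le_one S.beam
  rw [hmax]
  set R := S.txRadius .second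
  set D := S.rxRadius .second
  set s := Real.sin S.beam
  set c := Real.cos S.beam
  have hdisc : 0 ≤ R ^ 2 - D ^ 2 * s ^ 2 := by
    have : (D * s) ^ 2 ≤ R ^ 2 := pow_le_pow_left₀ (by nlinarith) hc1 2
    nlinarith
  set q := √(R ^ 2 - D ^ 2 * s ^ 2)
  have hq0 : 0 ≤ q := Real.sqrt_nonneg _
  have hq : q ^ 2 = R ^ 2 - D ^ 2 * s ^ 2 := Real.sq_sqrt hdisc
  have hD : 0 < D := hR.trans hRD
  -- `D * c ± q` are the roots of `r² - 2Dc r + (D² - R²)`, the distances at which the boundary ray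
  -- of the beam meets the sphere.
  have hprod : (D * c - q) * (D * c + q) = D ^ 2 - R ^ 2 := by
    linear_combination D ^ 2 * hsc - hq
  have hpos : 0 < D * c + q := by positivity
  have ha : 0 < D * c - q := by
    by_contra h
    have : (D * c - q) * (D * c + q) ≤ 0 := mul_nonpos_of_nonpos_of_nonneg (not_lt.1 h) hpos.le
    nlinarith
  -- The quadratic inequality says that `r` is not strictly between the roots. The horizon condition
  -- bounds `r²` by their product, which excludes the far side of the larger root.
  have key : ∀ r, 0 < r → (r ≤ D * c - q ↔
      r ^ 2 ≤ D ^ 2 - R ^ 2 ∧ 2 * D * r * c ≤ D ^ 2 - R ^ 2 + r ^ 2) := by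
    intro r hr
    rw [← hprod]
    constructor
    · intro h
      constructor <;> nlinarith
    · rintro ⟨h1, h2⟩
      by_contra h
      push Not at h
      have h3 : r < D * c + q := by
        by_contra h'
        push Not at h'
        nlinarith
      nlinarith [mul_pos (sub_pos.2 h) (sub_pos.2 h3)]
  refine ⟨(key _ (sub_pos.2 hRD)).2 ⟨?_, ?_⟩, ?_, key⟩
  · nlinarith
  · nlinarith [mul_nonneg (mul_pos hD (sub_pos.2 hRD)).le (sub_nonneg.2 hcos1)]
  · exact pow_le_pow_left₀ ha.le (by nlinarith) 2

theorem rMin_le_rMax {i : Hop} (hcap : S.CapFits i) : S.rMin i ≤ S.rMax i := by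
  have := S.Ha_pos
  have := S.Re_pos
  have := S.capHeight_pos
  cases i
  · exact Real.le_sqrt_of_sq_le (le_add_of_nonneg_right (by positivity))
  · exact (S.rMax_second hcap).1

/-- The sum of the radii is the distance to the farthest point of the sphere, so the range of
distances is not cut off before `rMax`. For the first hop this amounts to `capHeight ≤ 2 * Re`. -/
theorem rMax_sq_le {i : Hop} (hcap : S.CapFits i) :
    S.rMax i ^ 2 ≤ (S.rxRadius i + S.txRadius i) ^ 2 := by
  have := S.Ha_pos
  have := S.Re_pos
  have := S.capHeight_pos
  cases i
  · simp only [rMax, rxRadius, txRadius]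
    rw [Real.sq_sqrt (by positivity)]
    have h : S.capHeight ≤ 2 * S.Re := hcap
    nlinarith
  · exact (S.rMax_second hcap).2.1

/-- On the sphere the squared distance is a decreasing affine function of `⟪x, u⟫`, so a cap is a
ball in terms of distance. For the second hop, horizon and beam become the two inequalities of
`rMax_second`. -/
theorem mem_coverage_iff {i : Hop} (hcap : S.CapFits i) {u x : Space} (hu : ‖u‖ = 1)
    (hx : ‖x‖ = S.txRadius i) :
    x ∈ S.coverage i u ↔ dist x (S.receiver i u) ^ 2 ≤ S.rMax i ^ 2 := by
  have hd := dist_smul_sq (x := x) hu (S.rxRadius i)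
  rw [hx] at hd
  have := S.Ha_pos
  have := S.Re_pos
  have := S.capHeight_pos
  cases i
  · change (‖x‖ = S.Re ∧ S.Re - S.capHeight ≤ inner ℝ x u) ↔ dist x (S.rxRadius .first • u) ^ 2 ≤ _
    rw [hd]
    simp only [rMax, rxRadius, txRadius] at hx ⊢
    rw [Real.sq_sqrt (by positivity), and_iff_right hx]
    have hD : 0 < S.Re + S.Ha := by linarith
    constructor
    · intro h; nlinarith
    · intro h
      by_contra h'
      push Not at h'
      nlinarith
  · have hD := S.rxRadius_pos .second
    have hRD := S.txRadius_lt_rxRadius .second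
    have hR := S.txRadius_pos .second
    have h0 : 0 < dist x (S.receiver .second u) := by
      rw [dist_pos]
      rintro rfl
      rw [receiver, norm_smul, hu, Real.norm_of_nonneg hD.le] at hx
      linarith
    obtain ⟨h1, -, h2⟩ := S.rMax_second hcap
    have hmax0 := (S.rMin_pos .second).trans_le h1
    have hb := S.beam_pos
    have hbp : S.beam ≤ π := by linarith [hcap.1, Real.pi_pos]
    rw [pow_le_pow_iff_left₀ h0.le hmax0.le two_ne_zero, h2 _ h0]
    change (‖x‖ = S.txRadius .second ∧ S.txRadius .second ^ 2 ≤ S.rxRadius .second * inner ℝ x u ∧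
      InnerProductGeometry.angle (S.receiver .second u - x) u ≤ S.beam) ↔ _
    rw [and_iff_right hx]
    refine and_congr ?_ ?_
    · rw [receiver, hd]
      constructor <;> intro h <;> linarith
    -- The cosine decreases on `[0, π]`, so the bound on the angle is a lower bound on its cosine,
    -- hence on an inner product.
    · rw [← Real.strictAntiOn_cos.le_iff_ge ⟨hb.le, hbp⟩
        ⟨InnerProductGeometry.angle_nonneg _ _, InnerProductGeometry.angle_le_pi _ _⟩,
        InnerProductGeometry.cos_angle, hu, mul_one, ← dist_eq_norm, dist_comm _ x, le_div_iff₀ h0,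
        inner_sub_left, receiver, real_inner_smul_left, real_inner_self_eq_norm_sq, hu, hd]
      constructor <;> intro h <;> nlinarith

/-- The intensity measure, seen through the squared distance to the receiver, is uniform. -/
theorem map_intensity {i : Hop} (hcap : S.CapFits i) {u : Space} (hu : ‖u‖ = 1) :
    (S.intensity i u).map (fun x => dist x (S.receiver i u) ^ 2) =
      ENNReal.ofReal (S.Rdot i) • volume.restrict (Icc (S.rMin i ^ 2) (S.rMax i ^ 2)) := by
  have hm : Measurable fun x : Space => dist x (S.receiver i u) ^ 2 := by fun_prop
  have hcov : (S.coverage i u : Set Space) =ᵐ[sphereArea (S.txRadius i)]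
      {x | dist x (S.receiver i u) ^ 2 ≤ S.rMax i ^ 2} := by
    filter_upwards [ae_norm_sphereArea (S.txRadius_pos i).le] with x hx
    exact propext (S.mem_coverage_iff hcap hu hx)
  refine Measure.ext_of_lintegral _ fun F hF => ?_
  rw [lintegral_map hF hm, intensity, Measure.restrict_congr_set hcov, lintegral_smul_measure,
    lintegral_smul_measure, ← lintegral_indicator (measurableSet_le hm measurable_const)]
  have := lintegral_sphereArea_dist_sq hu (S.txRadius_pos i) (S.rxRadius_pos i)
    (hF.indicator (measurableSet_Iic (a := S.rMax i ^ 2)))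
  have e : ∀ x : Space, {x | dist x (S.receiver i u) ^ 2 ≤ S.rMax i ^ 2}.indicator
      (fun x => F (dist x (S.receiver i u) ^ 2)) x =
      (Iic (S.rMax i ^ 2)).indicator F (dist x (S.rxRadius i • u) ^ 2) := fun x => rfl
  simp_rw [e]
  rw [this, Rdot_eq, ENNReal.ofReal_mul (S.density_nonneg i), smul_eq_mul, smul_eq_mul, mul_assoc,
    setLIntegral_indicator measurableSet_Iic, ← S.rxRadius_sub_txRadius]
  congr 4
  ext y
  have := S.rMax_sq_le hcap
  simp only [mem_inter_iff, mem_Iic, mem_Icc]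
  exact ⟨fun h => ⟨h.2.1, h.1⟩, fun h => ⟨h.2, h.1, h.2.trans this⟩⟩

instance (i : Hop) (u : Space) : IsFiniteMeasure (S.intensity i u) := by
  unfold intensity
  exact Measure.smul_finite _ ENNReal.ofReal_ne_top

/-- Integrals over the interferers of functions of the squared link distance. -/
theorem integral_intensity {i : Hop} (hcap : S.CapFits i) {u : Space} (hu : ‖u‖ = 1)
    {F : ℝ → ℝ} (hF : Measurable F) :
    ∫ x, F (dist x (S.receiver i u) ^ 2) ∂(S.intensity i u) =
      S.Rdot i * ∫ y in (S.rMin i ^ 2)..(S.rMax i ^ 2), F y := by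
  have hm : Measurable fun x : Space => dist x (S.receiver i u) ^ 2 := by fun_prop
  have h := integral_map (μ := S.intensity i u) hm.aemeasurable (f := F) hF.aestronglyMeasurable
  rw [← h, S.map_intensity hcap hu, integral_smul_measure, ENNReal.toReal_ofReal (S.Rdot_nonneg i),
    integral_Icc_eq_integral_Ioc, ← intervalIntegral.integral_of_le, smul_eq_mul]
  exact pow_le_pow_left₀ (S.rMin_pos i).le (S.rMin_le_rMax hcap) 2

end Params

end

/-! ### The Poisson generating functional, independence, and the Gamma distribution. -/

section


open Set Filter Topology

theorem integral_pow_poissonMeasure (r : NNReal) (c : ℝ) :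
    ∫ n, c ^ n ∂(poissonMeasure r) = Real.exp (-((r : ℝ) * (1 - c))) := by
  rw [integral_poissonMeasure]
  have h := (NormedSpace.expSeries_div_hasSum_exp ((r : ℝ) * c)).mul_left (Real.exp (-(r : ℝ)))
  rw [← Real.exp_eq_exp_ℝ, ← Real.exp_add] at h
  rw [show -((r : ℝ) * (1 - c)) = -r + r * c by ring, ← h.tsum_eq]
  refine tsum_congr fun n => ?_
  rw [smul_eq_mul, mul_pow]
  ring

/-- Grouping the points by the value of `φ` leaves only counts, whose joint law is what
`IsPoissonProcess` prescribes. -/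
theorem prod_eq_prod_pow_count (φ : SimpleFunc Space ℝ) (n : ℕ) (x : ℕ → Space) :
    ∏ k ∈ Finset.range n, φ (x k) = ∏ c ∈ φ.range, c ^ count n x (φ ⁻¹' {c}) := by
  classical
  rw [← Finset.prod_fiberwise_of_maps_to' (t := φ.range) (g := fun k => φ (x k))
    (fun k _ => φ.mem_range_self _) (fun c => c)]
  refine Finset.prod_congr rfl fun c _ => ?_
  rw [Finset.prod_const]
  unfold count
  congr 2

namespace IsPoissonProcess

variable {Ω : Type*} [MeasurableSpace Ω] {μ : Measure Ω} {Λ : Measure Space} {N : Ω → ℕ}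
  {X : ℕ → Ω → Space}

/-- Without measurability `Measure.map` would be zero, which is not a Poisson law. -/
theorem aemeasurable_count (h : IsPoissonProcess μ Λ N X) {B : Set Space} (hB : MeasurableSet B) :
    AEMeasurable (fun ω => count (N ω) (fun n => X n ω) B) μ := by
  by_contra hn
  have := h.law_count B hB
  rw [Measure.map_of_not_aemeasurable hn] at this
  exact (IsProbabilityMeasure.ne_zero (poissonMeasure (Λ B).toNNReal)) this.symm

theorem integral_pow_count (h : IsPoissonProcess μ Λ N X) {B : Set Space} (hB : MeasurableSet B)
    (c : ℝ) :
    ∫ ω, c ^ count (N ω) (fun n => X n ω) B ∂μ = Real.exp (-(Λ.real B * (1 - c))) := by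
  have := integral_map (h.aemeasurable_count hB) (f := fun n : ℕ => c ^ n)
    (measurable_of_countable _).aestronglyMeasurable
  rw [← this, h.law_count B hB, integral_pow_poissonMeasure]
  rfl

/-- The level sets of `φ` are disjoint, so their counts are independent. Each value `c` contributes
the Poisson generating function `exp (-Λ(φ = c) (1 - c))`, and the exponents add up to the integral.
-/
theorem integral_prod_simpleFunc [IsFiniteMeasure Λ] (h : IsPoissonProcess μ Λ N X)
    (φ : SimpleFunc Space ℝ) :
    ∫ ω, ∏ k ∈ Finset.range (N ω), φ (X k ω) ∂μ = Real.exp (-∫ x, (1 - φ x) ∂Λ) := by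
  classical
  set e := φ.range.equivFin.symm
  have hdisj : Pairwise fun j j' => Disjoint (φ ⁻¹' {(e j : ℝ)}) (φ ⁻¹' {(e j' : ℝ)}) := by
    intro j j' hj
    refine Disjoint.preimage _ (disjoint_singleton.2 fun h' => hj ?_)
    exact e.injective (Subtype.ext h')
  have hind := h.indep_count _ (fun j => φ ⁻¹' {(e j : ℝ)}) (fun j => φ.measurableSet_preimage _)
    hdisj
  have hprod := hind.integral_fun_prod_comp (𝕜 := ℝ) (f := fun j n => (e j : ℝ) ^ n)
    (fun j => h.aemeasurable_count (φ.measurableSet_preimage _))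
    (fun j => (measurable_of_countable _).aestronglyMeasurable)
  have hreindex : ∀ ω, ∏ k ∈ Finset.range (N ω), φ (X k ω) =
      ∏ j, (e j : ℝ) ^ count (N ω) (fun n => X n ω) (φ ⁻¹' {(e j : ℝ)}) := by
    intro ω
    rw [prod_eq_prod_pow_count φ (N ω) (fun n => X n ω), ← Finset.prod_coe_sort]
    exact (e.prod_comp fun c : φ.range =>
      (c : ℝ) ^ count (N ω) (fun n => X n ω) (φ ⁻¹' {(c : ℝ)})).symm
  simp_rw [hreindex]
  rw [hprod]
  simp_rw [h.integral_pow_count (φ.measurableSet_preimage _)]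
  rw [← Real.exp_sum, Finset.sum_neg_distrib]
  congr 2
  have hpt : ∀ x, 1 - φ x = ∑ c ∈ φ.range, (φ ⁻¹' {c}).indicator (fun _ => 1 - c) x := by
    intro x
    rw [Finset.sum_eq_single (φ x)]
    · simp
    · intro c _ hc
      exact indicator_of_notMem (fun hx => hc hx.symm) _
    · intro hx
      exact absurd (φ.mem_range_self x) hx
  simp_rw [hpt]
  rw [integral_finsetSum _ fun c _ =>
    (integrable_const (1 - c)).indicator (φ.measurableSet_preimage _),
    ← Finset.sum_coe_sort φ.range, ← e.sum_comp]
  refine Finset.sum_congr rfl fun j _ => ?_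
  rw [integral_indicator_const _ (φ.measurableSet_preimage _), smul_eq_mul]

theorem measurable_prod (h : IsPoissonProcess μ Λ N X) {φ : Space → ℝ} (hφ : Measurable φ) :
    Measurable fun ω => ∏ k ∈ Finset.range (N ω), φ (X k ω) := by
  have : Measurable (Function.uncurry fun (n : ℕ) ω => ∏ k ∈ Finset.range n, φ (X k ω)) :=
    measurable_from_prod_countable_right fun n =>
      Finset.measurable_fun_prod (Finset.range n) fun k _ => hφ.comp (h.measurable_point k)
  exact this.comp (h.measurable_card.prodMk measurable_id)

/-- The probability generating functional of a Poisson process. -/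
theorem integral_prod [IsProbabilityMeasure μ] [IsFiniteMeasure Λ]
    (h : IsPoissonProcess μ Λ N X) {φ : Space → ℝ} (hφ : Measurable φ)
    (hφ01 : ∀ x, φ x ∈ Icc (0 : ℝ) 1) :
    ∫ ω, ∏ k ∈ Finset.range (N ω), φ (X k ω) ∂μ = Real.exp (-∫ x, (1 - φ x) ∂Λ) := by
  have h0 : (0 : ℝ) ∈ Icc (0 : ℝ) 1 := by simp
  -- Approximants with values in `[0, 1]` keep both the products and `1 - ψ n` bounded by `1`, so
  -- dominated convergence applies on both sides.
  set ψ : ℕ → SimpleFunc Space ℝ := fun n => SimpleFunc.approxOn φ hφ (Icc 0 1) 0 h0 n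
  have hψ : ∀ n x, ψ n x ∈ Icc (0 : ℝ) 1 := fun n x => SimpleFunc.approxOn_mem hφ h0 n x
  have hlim : ∀ x, Tendsto (fun n => ψ n x) atTop (𝓝 (φ x)) := fun x =>
    SimpleFunc.tendsto_approxOn hφ h0 (subset_closure (hφ01 x))
  have h1 : Tendsto (fun n => ∫ ω, ∏ k ∈ Finset.range (N ω), ψ n (X k ω) ∂μ) atTop
      (𝓝 (∫ ω, ∏ k ∈ Finset.range (N ω), φ (X k ω) ∂μ)) := by
    refine tendsto_integral_of_dominated_convergence (fun _ => 1)
      (fun n => (h.measurable_prod (ψ n).measurable).aestronglyMeasurable) (integrable_const 1)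
      (fun n => ae_of_all _ fun ω => ?_)
      (ae_of_all _ fun ω => tendsto_finsetProd _ fun k _ => hlim _)
    rw [Real.norm_of_nonneg (Finset.prod_nonneg fun k _ => (hψ n _).1)]
    exact Finset.prod_le_one (fun k _ => (hψ n _).1) fun k _ => (hψ n _).2
  have h2 : Tendsto (fun n => ∫ x, (1 - ψ n x) ∂Λ) atTop (𝓝 (∫ x, (1 - φ x) ∂Λ)) := by
    refine tendsto_integral_of_dominated_convergence (fun _ => 1)
      (fun n => (measurable_const.sub (ψ n).measurable).aestronglyMeasurable) (integrable_const 1)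
      (fun n => ae_of_all _ fun x => ?_)
      (ae_of_all _ fun x => (hlim x).const_sub 1)
    have := hψ n x
    rw [Real.norm_eq_abs, abs_le]
    exact ⟨by linarith [this.2], by linarith [this.1]⟩
  simp_rw [h.integral_prod_simpleFunc] at h1
  exact tendsto_nhds_unique h1 ((Real.continuous_exp.tendsto _).comp h2.neg)

end IsPoissonProcess

section Independence

variable {Ω α β γ : Type*} [MeasurableSpace Ω] [MeasurableSpace α] [MeasurableSpace β]
  [MeasurableSpace γ] {μ : Measure Ω}

/-- Associativity of the product of the three laws. -/
theorem indepFun_prodMk_right [IsProbabilityMeasure μ] {A : Ω → α} {B : Ω → β} {C : Ω → γ}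
    (hA : Measurable A)
    (hB : Measurable B) (hC : Measurable C) (hAB : IndepFun A B μ)
    (hABC : IndepFun (fun ω => (A ω, B ω)) C μ) : IndepFun A (fun ω => (B ω, C ω)) μ := by
  have hBC : IndepFun B C μ := hABC.comp measurable_snd measurable_id
  rw [indepFun_iff_map_prod_eq_prod_map_map hA.aemeasurable (by fun_prop)]
  rw [indepFun_iff_map_prod_eq_prod_map_map (by fun_prop) (by fun_prop)] at hAB hABC hBC
  have := Measure.isProbabilityMeasure_map (μ := μ) hA.aemeasurable
  have := Measure.isProbabilityMeasure_map (μ := μ) hB.aemeasurable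
  have := Measure.isProbabilityMeasure_map (μ := μ) hC.aemeasurable
  rw [hBC, ← Measure.prodAssoc_prod, ← hAB, ← hABC,
    Measure.map_map MeasurableEquiv.prodAssoc.measurable (by fun_prop)]
  rfl

/-- Integrals of functions of two independent variables are iterated integrals. -/
theorem integral_of_indepFun [IsProbabilityMeasure μ] {A : Ω → α} {B : Ω → β}
    (hA : Measurable A) (hB : Measurable B)
    (hAB : IndepFun A B μ) {F : α → β → ℝ} (hF : Measurable (Function.uncurry F))
    (hint : Integrable (fun ω => F (A ω) (B ω)) μ) :
    ∫ ω, F (A ω) (B ω) ∂μ = ∫ ω, ∫ ω', F (A ω) (B ω') ∂μ ∂μ := by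
  have := Measure.isProbabilityMeasure_map (μ := μ) hA.aemeasurable
  have := Measure.isProbabilityMeasure_map (μ := μ) hB.aemeasurable
  have h := (indepFun_iff_map_prod_eq_prod_map_map hA.aemeasurable hB.aemeasurable).1 hAB
  have h1 : ∫ ω, F (A ω) (B ω) ∂μ =
      ∫ p, Function.uncurry F p ∂(μ.map fun ω => (A ω, B ω)) :=
    (integral_map (hA.prodMk hB).aemeasurable hF.aestronglyMeasurable).symm
  have h2 : Integrable (Function.uncurry F) (μ.map fun ω => (A ω, B ω)) :=
    (integrable_map_measure hF.aestronglyMeasurable (by fun_prop)).2 hint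
  rw [h1, h, integral_prod _ (h ▸ h2), integral_map hA.aemeasurable]
  · refine integral_congr_ae (ae_of_all _ fun ω => ?_)
    exact integral_map hB.aemeasurable (hF.comp measurable_prodMk_left).aestronglyMeasurable
  · exact hF.stronglyMeasurable.integral_prod_right.aestronglyMeasurable

theorem indepFun_zero_succ {g : ℕ → Ω → ℝ} (hg : ∀ n, Measurable (g n)) (hind : iIndepFun g μ) :
    IndepFun (g 0) (fun ω n => g (n + 1) ω) μ := by
  have h := indep_iSup_of_disjoint (fun n => (hg n).comap_le) hind.iIndep
    (S := {0}) (T := {0}ᶜ) disjoint_compl_right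
  refine indep_of_indep_of_le_left (indep_of_indep_of_le_right h ?_) ?_
  · rw [← measurable_iff_comap_le]
    refine @measurable_pi_lambda _ _ _ (_) _ _ fun n => ?_
    rw [measurable_iff_comap_le]
    exact le_iSup₂_of_le (f := fun i (_ : i ∈ ({0}ᶜ : Set ℕ)) =>
      MeasurableSpace.comap (g i) inferInstance) (n + 1) (by simp) le_rfl
  · exact le_iSup₂_of_le (f := fun i (_ : i ∈ ({0} : Set ℕ)) =>
      MeasurableSpace.comap (g i) inferInstance) 0 rfl le_rfl

end Independence

section Gamma

variable {m : ℕ} {r : ℝ}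

theorem integral_gammaMeasure (hm : 1 ≤ m) (hr : 0 < r) (F : ℝ → ℝ) :
    ∫ x, F x ∂(gammaMeasure m r) =
      ∫ x in Ioi 0, r ^ m / ((m - 1).factorial : ℝ) * x ^ (m - 1) * Real.exp (-(r * x)) * F x := by
  have hm0 : (0 : ℝ) < m := by exact_mod_cast hm
  have hpdf : Measurable (gammaPDF m r) := (measurable_gammaPDFReal _ _).ennreal_ofReal
  rw [gammaMeasure, integral_withDensity_eq_integral_toReal_smul hpdf
    (ae_of_all _ fun x => ENNReal.ofReal_lt_top), ← integral_Ici_eq_integral_Ioi,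
    ← integral_indicator measurableSet_Ici]
  refine integral_congr_ae (ae_of_all _ fun x => ?_)
  simp only [gammaPDF, ENNReal.toReal_ofReal (gammaPDFReal_nonneg hm0 hr x), smul_eq_mul]
  by_cases hx : 0 ≤ x
  · have hf : Real.Gamma m = ((m - 1).factorial : ℝ) := by
      rw [← Real.Gamma_nat_eq_factorial, Nat.cast_sub hm]
      simp
    have hp : x ^ ((m : ℝ) - 1) = x ^ (m - 1) := by
      rw [← Real.rpow_natCast, Nat.cast_sub hm, Nat.cast_one]
    simp [gammaPDFReal, hx, hf, hp]
  · simp [gammaPDFReal, hx]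

theorem integral_exp_neg_gammaMeasure (hm : 1 ≤ m) (hr : 0 < r) {z : ℝ} (hz : 0 ≤ z) :
    ∫ x, Real.exp (-(z * r * x)) ∂(gammaMeasure m r) = ((1 + z) ^ m)⁻¹ := by
  rw [integral_gammaMeasure hm hr]
  have hz1 : 0 < 1 + z := by linarith
  have e : ∀ x ∈ Ioi (0 : ℝ), r ^ m / ((m - 1).factorial : ℝ) * x ^ (m - 1) *
      Real.exp (-(r * x)) * Real.exp (-(z * r * x)) =
      r ^ m / ((m - 1).factorial : ℝ) * (x ^ ((m : ℝ) - 1) * Real.exp (-((1 + z) * r * x))) := by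
    intro x _
    rw [mul_assoc _ (Real.exp _), ← Real.exp_add, mul_assoc, ← Real.rpow_natCast x (m - 1),
      Nat.cast_sub hm, Nat.cast_one]
    ring_nf
  rw [setIntegral_congr_fun measurableSet_Ioi e, integral_const_mul,
    Real.integral_rpow_mul_exp_neg_mul_Ioi (by exact_mod_cast hm) (by positivity),
    Real.rpow_natCast]
  have hf : Real.Gamma m = ((m - 1).factorial : ℝ) := by
    rw [← Real.Gamma_nat_eq_factorial, Nat.cast_sub hm]
    simp
  rw [hf]
  have : ((m - 1).factorial : ℝ) ≠ 0 := by positivity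
  rw [one_div, inv_pow, mul_pow]
  field_simp

/-- The derivative telescopes; this yields an antiderivative of the Gamma density of integer shape
that vanishes at infinity. -/
theorem hasDerivAt_exp_neg_mul_sum (m : ℕ) (t : ℝ) :
    HasDerivAt (fun t : ℝ => -(Real.exp (-t) * ∑ k ∈ Finset.range (m + 1), t ^ k / (k.factorial : ℝ)))
      (t ^ m / (m.factorial : ℝ) * Real.exp (-t)) t := by
  have he : HasDerivAt (fun t : ℝ => Real.exp (-t)) (Real.exp (-t) * -1) t :=
    (hasDerivAt_neg' t).exp
  induction m with
  | zero =>
    have := he.fun_neg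
    simpa using this
  | succ m ih =>
    have h1 := he.fun_mul ((hasDerivAt_pow (m + 1) t).div_const ((m + 1).factorial : ℝ))
    have h2 := ih.fun_sub h1
    have e : (fun t : ℝ => -(Real.exp (-t) *
        ∑ k ∈ Finset.range (m + 1 + 1), t ^ k / (k.factorial : ℝ))) =
        fun t => -(Real.exp (-t) * ∑ k ∈ Finset.range (m + 1), t ^ k / (k.factorial : ℝ)) -
          Real.exp (-t) * (t ^ (m + 1) / ((m + 1).factorial : ℝ)) := by
      ext s
      rw [Finset.sum_range_succ _ (m + 1)]
      ring
    rw [e]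
    refine h2.congr_deriv ?_
    rw [Nat.factorial_succ]
    have : (m.factorial : ℝ) ≠ 0 := by positivity
    push_cast
    field_simp
    ring_nf

theorem measureReal_gammaMeasure_Ioi (hm : 1 ≤ m) (hr : 0 < r) {y : ℝ} (hy : 0 ≤ y) :
    (gammaMeasure m r).real {x | y < r * x} =
      ∑ k ∈ Finset.range m, Real.exp (-y) * y ^ k / (k.factorial : ℝ) := by
  have hms : MeasurableSet {x : ℝ | y < r * x} :=
    measurableSet_lt measurable_const (by fun_prop)
  rw [← integral_indicator_one hms, integral_gammaMeasure hm hr]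
  have hset : {x : ℝ | y < r * x} = Ioi (y / r) := by
    ext x
    simp [div_lt_iff₀ hr, mul_comm]
  obtain ⟨n, rfl⟩ : ∃ n, m = n + 1 := ⟨m - 1, by omega⟩
  set Q : ℝ → ℝ :=
    fun t => -(Real.exp (-t) * ∑ k ∈ Finset.range (n + 1), t ^ k / (k.factorial : ℝ))
  have hderiv : ∀ x : ℝ, HasDerivAt (fun x => Q (r * x))
      (r ^ (n + 1) / (n.factorial : ℝ) * x ^ n * Real.exp (-(r * x))) x := by
    intro x
    have := (hasDerivAt_exp_neg_mul_sum n (r * x)).comp x ((hasDerivAt_id' x).const_mul r)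
    refine this.congr_deriv ?_
    rw [mul_pow]
    ring
  have hQ : Tendsto Q atTop (𝓝 0) := by
    have h1 : ∀ k : ℕ, Tendsto (fun t : ℝ => t ^ k * Real.exp (-t) / (k.factorial : ℝ)) atTop (𝓝 0) := by
      intro k
      simpa using (Real.tendsto_pow_mul_exp_neg_atTop_nhds_zero k).div_const (k.factorial : ℝ)
    have h2 := (tendsto_finsetSum (Finset.range (n + 1)) fun k _ => h1 k).neg
    simp only [Finset.sum_const_zero, neg_zero] at h2
    refine h2.congr fun t => ?_
    simp only [Q, Finset.mul_sum]
    congr 1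
    exact Finset.sum_congr rfl fun k _ => by ring
  have hlim : Tendsto (fun x => Q (r * x)) atTop (𝓝 0) :=
    hQ.comp (tendsto_id.const_mul_atTop hr)
  have hyr : 0 ≤ y / r := by positivity
  have hint := integral_Ioi_of_hasDerivAt_of_nonneg' (a := y / r) (fun x _ => hderiv x)
    (fun x hx => by have : 0 < x := hyr.trans_lt hx; positivity) hlim
  have e : ∀ x, r ^ (n + 1) / ((n + 1 - 1).factorial : ℝ) * x ^ (n + 1 - 1) * Real.exp (-(r * x)) *
      {x : ℝ | y < r * x}.indicator 1 x = (Ioi (y / r)).indicator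
        (fun x => r ^ (n + 1) / (n.factorial : ℝ) * x ^ n * Real.exp (-(r * x))) x := by
    intro x
    rw [hset]
    by_cases hx : x ∈ Ioi (y / r) <;> simp [hx]
  simp_rw [e]
  rw [setIntegral_indicator measurableSet_Ioi, inter_eq_right.2 (Ioi_subset_Ioi hyr), hint,
    mul_div_cancel₀ _ hr.ne', zero_sub]
  simp only [Q, neg_neg, Finset.mul_sum, mul_div_assoc]

theorem ae_nonneg_gammaMeasure : ∀ᵐ x ∂(gammaMeasure m r), 0 ≤ x := by
  rw [ae_iff, gammaMeasure, withDensity_apply _ (by measurability)]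
  simp only [not_le]
  exact lintegral_gammaPDF_of_nonpos le_rfl

end Gamma

end

/-! ### Coefficients of the exponential of a power series, by asymptotics at `0` from the right. -/

section


open Filter Topology Asymptotics

section Coefficients

theorem tendsto_pow_zero_nhdsGT {n : ℕ} (hn : n ≠ 0) :
    Tendsto (fun w : ℝ => w ^ n) (𝓝[>] 0) (𝓝 0) := by
  have : Tendsto (fun w : ℝ => w ^ n) (𝓝 0) (𝓝 (0 ^ n)) := (continuous_pow n).tendsto 0
  rw [zero_pow hn] at this
  exact this.mono_left nhdsWithin_le_nhds

/-- Letting `w → 0` kills the constant term; dividing by `w` lowers the degree. A one-sided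
neighbourhood suffices, which matters because the generating functions are compared on `[0, 1]`
only. -/
theorem coeff_eq_zero_of_isBigO {n : ℕ} {a : ℕ → ℝ}
    (h : (fun w : ℝ => ∑ j ∈ Finset.range n, a j * w ^ j) =O[𝓝[>] 0] fun w => w ^ n) :
    ∀ j < n, a j = 0 := by
  induction n generalizing a with
  | zero => simp
  | succ n ih =>
    have h0 : a 0 = 0 := by
      have h1 : Tendsto (fun w : ℝ => ∑ j ∈ Finset.range (n + 1), a j * w ^ j) (𝓝[>] 0) (𝓝 0) :=
        h.trans_tendsto (tendsto_pow_zero_nhdsGT n.succ_ne_zero)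
      have h2 : Tendsto (fun w : ℝ => ∑ j ∈ Finset.range (n + 1), a j * w ^ j) (𝓝[>] 0)
          (𝓝 (∑ j ∈ Finset.range (n + 1), a j * (0 : ℝ) ^ j)) := by
        have hc : Continuous fun w : ℝ => ∑ j ∈ Finset.range (n + 1), a j * w ^ j := by fun_prop
        exact (hc.tendsto 0).mono_left nhdsWithin_le_nhds
      rw [tendsto_nhds_unique h1 h2, Finset.sum_range_succ', Finset.sum_eq_zero]
      · simp
      · intro j _
        simp
    have h3 : (fun w : ℝ => ∑ j ∈ Finset.range n, a (j + 1) * w ^ j) =O[𝓝[>] 0]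
        fun w => w ^ n := by
      refine ((isBigO_refl (fun w : ℝ => w⁻¹) (𝓝[>] 0)).mul h).congr' ?_ ?_
      · filter_upwards [self_mem_nhdsWithin] with w hw
        have hw' : w ≠ 0 := ne_of_gt hw
        rw [Finset.sum_range_succ', h0, zero_mul, add_zero, Finset.mul_sum]
        refine Finset.sum_congr rfl fun j _ => ?_
        rw [pow_succ]
        field_simp
      · filter_upwards [self_mem_nhdsWithin] with w hw
        have hw' : w ≠ 0 := ne_of_gt hw
        rw [pow_succ]
        field_simp
    intro j hj
    rcases j with _ | j
    · exact h0
    · exact ih h3 j (by omega)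

theorem isBigO_pow_of_le {m n : ℕ} (h : n ≤ m) :
    (fun w : ℝ => w ^ m) =O[𝓝[>] 0] fun w => w ^ n :=
  (IsBigO.of_bound 1 (by
    filter_upwards [Ioc_mem_nhdsGT one_pos] with w hw
    rw [norm_pow, norm_pow, one_mul, Real.norm_of_nonneg hw.1.le]
    exact pow_le_pow_of_le_one hw.1.le hw.2 h))

/-- A power series agrees with its partial sums to the expected order. -/
theorem isBigO_sub_sum_range {a : ℕ → ℝ} (ha : Summable fun j => |a j|) {f : ℝ → ℝ}
    (hf : ∀ w ∈ Set.Icc (0 : ℝ) 1, HasSum (fun j => a j * w ^ j) (f w)) (n : ℕ) :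
    (fun w => f w - ∑ j ∈ Finset.range n, a j * w ^ j) =O[𝓝[>] 0] fun w => w ^ n := by
  refine IsBigO.of_bound (∑' j, |a (j + n)|) ?_
  have hmem : Set.Ioc (0 : ℝ) 1 ∈ 𝓝[>] (0 : ℝ) := Ioc_mem_nhdsGT one_pos
  filter_upwards [hmem] with w hw
  have hw01 : w ∈ Set.Icc (0 : ℝ) 1 := ⟨hw.1.le, hw.2⟩
  have h1 := (hasSum_nat_add_iff' n).2 (hf w hw01)
  rw [← h1.tsum_eq, Real.norm_eq_abs, Real.norm_eq_abs, abs_of_nonneg (pow_nonneg hw.1.le n),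
    ← tsum_mul_right]
  have hs : Summable fun j => |a (j + n)| * w ^ n :=
    ((summable_nat_add_iff n).2 ha).mul_right _
  refine tsum_of_norm_bounded (f := fun j => a (j + n) * w ^ (j + n)) hs.hasSum fun j => ?_
  rw [Real.norm_eq_abs, abs_mul, abs_of_nonneg (pow_nonneg hw.1.le _), pow_add]
  refine mul_le_mul_of_nonneg_left ?_ (abs_nonneg _)
  exact mul_le_of_le_one_left (pow_nonneg hw.1.le _) (pow_le_one₀ hw.1.le hw.2)

/-- Induction through `f F - g G = f (F - G) + (f - g) G`. -/
theorem isBigO_prod_sub_prod {ι : Type*} (s : Finset ι) {n : ℕ} {f g : ι → ℝ → ℝ}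
    (hfg : ∀ i ∈ s, (fun w => f i w - g i w) =O[𝓝[>] 0] fun w => w ^ n)
    (hf : ∀ i ∈ s, f i =O[𝓝[>] 0] fun _ => (1 : ℝ))
    (hg : ∀ i ∈ s, g i =O[𝓝[>] 0] fun _ => (1 : ℝ)) :
    (fun w => ∏ i ∈ s, f i w - ∏ i ∈ s, g i w) =O[𝓝[>] 0] fun w => w ^ n := by
  classical
  induction s using Finset.induction_on with
  | empty => simpa using isBigO_zero _ _
  | insert i s hi ih =>
    have hgs : (fun w => ∏ i ∈ s, g i w) =O[𝓝[>] 0] fun _ => (1 : ℝ) := by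
      have := IsBigO.finsetProd (s := s) (f := fun i w => g i w) (g := fun _ _ => (1 : ℝ))
        (l := 𝓝[>] (0 : ℝ)) fun i hi => hg i (Finset.mem_insert_of_mem hi)
      simpa using this
    have h1 := (hf i (Finset.mem_insert_self i s)).mul
      (ih (fun j hj => hfg j (Finset.mem_insert_of_mem hj))
        (fun j hj => hf j (Finset.mem_insert_of_mem hj))
        (fun j hj => hg j (Finset.mem_insert_of_mem hj)))
    have h2 := (hfg i (Finset.mem_insert_self i s)).mul hgs
    simp only [one_mul, mul_one] at h1 h2
    refine (h1.add h2).congr_left fun w => ?_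
    rw [Finset.prod_insert hi, Finset.prod_insert hi]
    ring

theorem isBigO_one_of_continuous {f : ℝ → ℝ} (hf : Continuous f) :
    f =O[𝓝[>] 0] fun _ => (1 : ℝ) :=
  ((hf.tendsto 0).isBigO_one ℝ).mono nhdsWithin_le_nhds

/-- The remainder has order `(j + 1) * n ≥ n`, so powers up to `n - 1` are enough for every `j`. -/
theorem isBigO_exp_monomial (c : ℝ) (j n : ℕ) :
    (fun w : ℝ => Real.exp (c * w ^ (j + 1)) -
      ∑ b : Fin n, (c * w ^ (j + 1)) ^ (b : ℕ) / ((b : ℕ).factorial : ℝ))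
      =O[𝓝[>] 0] fun w => w ^ n := by
  have h0 : Tendsto (fun w : ℝ => c * w ^ (j + 1)) (𝓝[>] 0) (𝓝 0) := by
    simpa using (tendsto_pow_zero_nhdsGT j.succ_ne_zero).const_mul c
  have h1 := (Real.exp_sub_sum_range_isBigO_pow n).comp_tendsto h0
  have h2 : (fun w : ℝ => (c * w ^ (j + 1)) ^ n) =O[𝓝[>] 0] fun w => w ^ n := by
    have := (isBigO_pow_of_le (m := (j + 1) * n) (n := n) (by nlinarith)).const_mul_left (c ^ n)
    refine this.congr_left fun w => ?_
    rw [mul_pow, pow_mul]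
  refine (h1.trans h2).congr_left fun w => ?_
  simp only [Function.comp_apply]
  rw [Finset.sum_range fun i => (c * w ^ (j + 1)) ^ i / (i.factorial : ℝ)]

/-- The coefficient of order `k` of the exponential of a power series without constant term. -/
noncomputable def expCoeff (c : ℕ → ℝ) (k : ℕ) : ℝ :=
  ∑ b : Fin k → Fin (k + 1) with ∑ j : Fin k, ((j : ℕ) + 1) * (b j : ℕ) = k,
    ∏ j : Fin k, c ((j : ℕ) + 1) ^ (b j : ℕ) / ((b j : ℕ).factorial : ℝ)

theorem isBigO_exp_sub {h q : ℝ → ℝ} {n : ℕ} (hn : n ≠ 0) (hq : Continuous q)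
    (hhq : (fun w => h w - q w) =O[𝓝[>] 0] fun w => w ^ n) :
    (fun w => Real.exp (h w) - Real.exp (q w)) =O[𝓝[>] 0] fun w => w ^ n := by
  have h0 : Tendsto (fun w => h w - q w) (𝓝[>] 0) (𝓝 0) :=
    hhq.trans_tendsto (tendsto_pow_zero_nhdsGT hn)
  have h1 := (Real.exp_sub_sum_range_isBigO_pow 1).comp_tendsto h0
  have h2 : (fun w => Real.exp (h w - q w) - 1) =O[𝓝[>] 0] fun w => w ^ n := by
    refine IsBigO.trans (h1.congr (fun w => ?_) fun w => ?_) hhq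
    · simp
    · simp
  have h3 := (isBigO_one_of_continuous (Real.continuous_exp.comp hq)).mul h2
  simp only [one_mul] at h3
  refine h3.congr_left fun w => ?_
  simp only [Function.comp_apply]
  rw [mul_sub, ← Real.exp_add, add_sub_cancel, mul_one]

/-- Everything is computed modulo `O(w^(k+1))`. The exponent may be cut to its first `k` terms; its
exponential is a product of `k` exponentials of monomials, each of which may be truncated.
Multiplying out gives a sum over `b` of monomials of degree `∑ (j + 1) * b j`, and those of degree
above `k` are negligible. The resulting polynomials then have equal coefficients. -/
theorem exp_series_coeff {p c : ℕ → ℝ} {K : ℝ} (hp : Summable fun k => |p k|)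
    (hc : Summable fun l => |c (l + 1)|)
    (h : ∀ w ∈ Set.Icc (0 : ℝ) 1,
      HasSum (fun k => p k * w ^ k) (K * Real.exp (∑' l, c (l + 1) * w ^ (l + 1)))) (k : ℕ) :
    p k = K * expCoeff c k := by
  classical
  -- The exponent starts at order one, whereas `c 0` is arbitrary (`base` does not vanish at `0` in
  -- general).
  set c' : ℕ → ℝ := fun l => if l = 0 then 0 else c l
  have hc's : ∀ l, c' (l + 1) = c (l + 1) := fun l => by simp [c']
  have hc' : Summable fun l => |c' l| := by
    rw [← summable_nat_add_iff 1]
    simpa [hc's] using hc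
  set H : ℝ → ℝ := fun w => ∑' l, c (l + 1) * w ^ (l + 1)
  have hH : ∀ w ∈ Set.Icc (0 : ℝ) 1, HasSum (fun l => c' l * w ^ l) (H w) := by
    intro w hw
    rw [← hasSum_nat_add_iff' 1]
    have hs : Summable fun l => c (l + 1) * w ^ (l + 1) := by
      refine Summable.of_norm_bounded hc fun l => ?_
      rw [Real.norm_eq_abs, abs_mul, abs_of_nonneg (pow_nonneg hw.1 _)]
      exact mul_le_of_le_one_right (abs_nonneg _) (pow_le_one₀ hw.1 hw.2)
    simpa [hc's, c'] using hs.hasSum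
  set q : ℝ → ℝ := fun w => ∑ j : Fin k, c ((j : ℕ) + 1) * w ^ ((j : ℕ) + 1)
  have hHq : (fun w => H w - q w) =O[𝓝[>] 0] fun w => w ^ (k + 1) := by
    refine (isBigO_sub_sum_range hc' hH (k + 1)).congr_left fun w => ?_
    rw [Finset.sum_range_succ', Finset.sum_range]
    simp [hc's, c', q]
  have h1 := isBigO_exp_sub k.succ_ne_zero (by fun_prop) hHq
  set E : (Fin k → Fin (k + 1)) → ℕ := fun b => ∑ j : Fin k, ((j : ℕ) + 1) * (b j : ℕ)
  set C : (Fin k → Fin (k + 1)) → ℝ := fun b =>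
    ∏ j : Fin k, c ((j : ℕ) + 1) ^ (b j : ℕ) / ((b j : ℕ).factorial : ℝ)
  have h2 : (fun w => Real.exp (q w) - ∑ b, C b * w ^ E b) =O[𝓝[>] 0] fun w => w ^ (k + 1) := by
    have := isBigO_prod_sub_prod (Finset.univ : Finset (Fin k)) (n := k + 1)
      (f := fun j w => Real.exp (c ((j : ℕ) + 1) * w ^ ((j : ℕ) + 1)))
      (g := fun j w => ∑ b : Fin (k + 1),
        (c ((j : ℕ) + 1) * w ^ ((j : ℕ) + 1)) ^ (b : ℕ) / ((b : ℕ).factorial : ℝ))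
      (fun j _ => isBigO_exp_monomial _ _ _)
      (fun j _ => isBigO_one_of_continuous (by fun_prop))
      (fun j _ => isBigO_one_of_continuous (by fun_prop))
    refine this.congr_left fun w => ?_
    rw [Real.exp_sum, Finset.prod_univ_sum, Fintype.piFinset_univ]
    congr 1
    refine Finset.sum_congr rfl fun b _ => ?_
    simp only [C, E]
    rw [← Finset.prod_pow_eq_pow_sum, ← Finset.prod_mul_distrib]
    refine Finset.prod_congr rfl fun j _ => ?_
    rw [mul_pow, ← pow_mul]
    ring
  have h3 : (fun w : ℝ => ∑ b, C b * w ^ E b -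
      ∑ j ∈ Finset.range (k + 1), (∑ b with E b = j, C b) * w ^ j) =O[𝓝[>] 0]
      fun w => w ^ (k + 1) := by
    have : (fun w : ℝ => ∑ b with ¬ E b < k + 1, C b * w ^ E b) =O[𝓝[>] 0]
        fun w => w ^ (k + 1) := by
      refine IsBigO.fun_sum fun b hb => ?_
      exact (isBigO_pow_of_le (not_lt.1 (Finset.mem_filter.1 hb).2)).const_mul_left _
    refine this.congr_left fun w => ?_
    rw [← Finset.sum_filter_add_sum_filter_not Finset.univ (fun b => E b < k + 1)]
    rw [← Finset.sum_fiberwise_of_maps_to (s := Finset.univ.filter fun b => E b < k + 1)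
      (t := Finset.range (k + 1)) (g := E) (fun b hb => by simpa using hb), eq_comm, sub_eq_iff_eq_add,
      add_comm]
    congr 1
    refine Finset.sum_congr rfl fun j hj => ?_
    rw [Finset.sum_mul, Finset.filter_filter]
    refine Finset.sum_congr ?_ fun b hb => ?_
    · ext b
      have := Finset.mem_range.1 hj
      simp only [Finset.mem_filter, Finset.mem_univ, true_and]
      constructor
      · rintro ⟨-, h⟩; exact h
      · intro h; exact ⟨by omega, h⟩
    · rw [(Finset.mem_filter.1 hb).2]
  have h4 := isBigO_sub_sum_range hp h (k + 1)
  have h5 := (((h1.add h2).add h3).const_mul_left K).sub h4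
  have h6 := coeff_eq_zero_of_isBigO (n := k + 1) (a := fun j => p j - K * ∑ b with E b = j, C b)
    (h5.congr_left fun w => by
      simp only [sub_mul, Finset.sum_sub_distrib, H, mul_assoc, ← Finset.mul_sum]
      ring) k k.lt_succ_self
  exact sub_eq_zero.1 h6

end Coefficients

end

/-! ### Power series in `w` of the exponent and of the Laplace transform at `1 - w`. -/

section


open Set Filter Topology

section NegativeBinomial

/-- Since `1 + (1 - w) c = (1 + c) (1 - c w / (1 + c))`, this is the negative binomial series with a
ratio below `1`, even at `w = 1`. -/
theorem hasSum_negBinomial {m : ℕ} (hm : 1 ≤ m) {c w : ℝ} (hc : 0 ≤ c) (hw : w ∈ Icc (0 : ℝ) 1) :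
    HasSum (fun l : ℕ => ((m + l - 1).choose l : ℝ) * (c ^ l * ((1 + c) ^ (m + l))⁻¹) * w ^ l)
      ((1 + (1 - w) * c) ^ m)⁻¹ := by
  obtain ⟨n, rfl⟩ : ∃ n, m = n + 1 := ⟨m - 1, by omega⟩
  have hc1 : 0 < 1 + c := by linarith
  have hr0 : 0 ≤ c * w / (1 + c) := div_nonneg (mul_nonneg hc hw.1) hc1.le
  have hr : ‖c * w / (1 + c)‖ < 1 := by
    rw [Real.norm_of_nonneg hr0, div_lt_one hc1]
    nlinarith [hw.1, hw.2]
  have h := (hasSum_choose_mul_geometric_of_norm_lt_one n hr).mul_left ((1 + c) ^ (n + 1))⁻¹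
  have e : ((1 + c) ^ (n + 1))⁻¹ * (1 / (1 - c * w / (1 + c)) ^ (n + 1)) =
      ((1 + (1 - w) * c) ^ (n + 1))⁻¹ := by
    rw [one_div, ← mul_inv, ← mul_pow]
    congr 2
    field_simp
    ring
  rw [e] at h
  refine h.congr_fun fun l => ?_
  have : (n + 1 + l - 1).choose l = (l + n).choose n := by
    rw [show n + 1 + l - 1 = l + n by omega, ← Nat.choose_symm_add]
  rw [this, div_pow, mul_pow, pow_add]
  field_simp

end NegativeBinomial

namespace Params

variable (S : Params)

theorem epsD_eq (i : Hop) (r₀ : ℝ) (l : ℕ) :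
    S.epsD i r₀ l = ∫ y in (S.rMin i ^ 2)..(S.rMax i ^ 2), ((S.m i + l - 1).choose l : ℝ) *
      ((S.theta i * r₀ ^ 2 / y) ^ l * ((1 + S.theta i * r₀ ^ 2 / y) ^ (S.m i + l))⁻¹) := by
  rw [epsD, intervalIntegral.integral_const_mul]

theorem ratio_nonneg (i : Hop) (r₀ : ℝ) {y : ℝ} (hy : 0 ≤ y) : 0 ≤ S.theta i * r₀ ^ 2 / y :=
  div_nonneg (mul_nonneg (S.theta_pos i).le (sq_nonneg _)) hy

theorem rMin_sq_le_rMax_sq {i : Hop} (hcap : S.CapFits i) : S.rMin i ^ 2 ≤ S.rMax i ^ 2 :=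
  pow_le_pow_left₀ (S.rMin_pos i).le (S.rMin_le_rMax hcap) 2

/-- Termwise integration of the negative binomial series. The terms at `w = 1` are nonnegative with
sum `1`, so they dominate. -/
theorem hasSum_epsD {i : Hop} (hcap : S.CapFits i) (r₀ : ℝ) {w : ℝ} (hw : w ∈ Icc (0 : ℝ) 1) :
    HasSum (fun l => S.epsD i r₀ l * w ^ l)
      (∫ y in (S.rMin i ^ 2)..(S.rMax i ^ 2),
        ((1 + (1 - w) * (S.theta i * r₀ ^ 2 / y)) ^ S.m i)⁻¹) := by
  simp_rw [epsD_eq, ← intervalIntegral.integral_mul_const]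
  have hpos : ∀ y ∈ uIoc (S.rMin i ^ 2) (S.rMax i ^ 2), 0 ≤ S.theta i * r₀ ^ 2 / y := by
    intro y hy
    rw [uIoc_of_le (S.rMin_sq_le_rMax_sq hcap)] at hy
    exact S.ratio_nonneg i r₀ ((sq_nonneg _).trans hy.1.le)
  have h1 : ∀ y ∈ uIoc (S.rMin i ^ 2) (S.rMax i ^ 2), HasSum (fun l =>
      ((S.m i + l - 1).choose l : ℝ) *
      ((S.theta i * r₀ ^ 2 / y) ^ l * ((1 + S.theta i * r₀ ^ 2 / y) ^ (S.m i + l))⁻¹)) 1 := by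
    intro y hy
    simpa using hasSum_negBinomial (S.m_pos i) (hpos y hy) (w := 1) (by simp)
  refine intervalIntegral.hasSum_integral_of_dominated_convergence
    (fun l y => ((S.m i + l - 1).choose l : ℝ) *
      ((S.theta i * r₀ ^ 2 / y) ^ l * ((1 + S.theta i * r₀ ^ 2 / y) ^ (S.m i + l))⁻¹))
    (fun l => Measurable.aestronglyMeasurable (by fun_prop))
    (fun l => ae_of_all _ fun y hy => ?_) (ae_of_all _ fun y hy => (h1 y hy).summable) ?_
    (ae_of_all _ fun y hy => hasSum_negBinomial (S.m_pos i) (hpos y hy) hw)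
  · have h0 := hpos y hy
    rw [Real.norm_of_nonneg (mul_nonneg (by positivity) (pow_nonneg hw.1 l))]
    exact mul_le_of_le_one_right (by positivity) (pow_le_one₀ hw.1 hw.2)
  · refine (intervalIntegrable_const (c := (1 : ℝ))).congr fun y hy => ?_
    exact ((h1 y hy).tsum_eq).symm

theorem intervalIntegrable_inv_pow {i : Hop} (hcap : S.CapFits i) (r₀ : ℝ) {w : ℝ}
    (hw : w ∈ Icc (0 : ℝ) 1) :
    IntervalIntegrable (fun y => ((1 + (1 - w) * (S.theta i * r₀ ^ 2 / y)) ^ S.m i)⁻¹) volume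
      (S.rMin i ^ 2) (S.rMax i ^ 2) := by
  refine (intervalIntegrable_const (c := (1 : ℝ))).mono_fun'
    (Measurable.aestronglyMeasurable (by fun_prop)) ?_
  refine (ae_restrict_iff' measurableSet_uIoc).2 (ae_of_all _ fun y hy => ?_)
  rw [uIoc_of_le (S.rMin_sq_le_rMax_sq hcap)] at hy
  have h0 := mul_nonneg (sub_nonneg.2 hw.2) (S.ratio_nonneg i r₀ ((sq_nonneg _).trans hy.1.le))
  change ‖((1 + (1 - w) * (S.theta i * r₀ ^ 2 / y)) ^ S.m i)⁻¹‖ ≤ 1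
  rw [Real.norm_of_nonneg (by positivity)]
  exact inv_le_one_of_one_le₀ (one_le_pow₀ (by linarith))

theorem hasSum_base {i : Hop} (hcap : S.CapFits i) (r₀ : ℝ) {w : ℝ} (hw : w ∈ Icc (0 : ℝ) 1) :
    HasSum (fun l => S.base i r₀ (l + 1) * w ^ (l + 1))
      (S.Sdot i r₀ + S.Rdot i * S.eps i r₀ - ((1 - w) * S.Sdot i r₀ + S.Rdot i *
        ∫ y in (S.rMin i ^ 2)..(S.rMax i ^ 2),
          (1 - ((1 + (1 - w) * (S.theta i * r₀ ^ 2 / y)) ^ S.m i)⁻¹))) := by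
  have h1 := ((hasSum_nat_add_iff' 1).2 (S.hasSum_epsD hcap r₀ hw)).mul_left (S.Rdot i)
  have h2 : HasSum (fun l : ℕ => if l = 0 then S.Sdot i r₀ * w else 0) (S.Sdot i r₀ * w) :=
    hasSum_ite_eq 0 _
  have h0 : (0 : ℝ) ∈ Icc (0 : ℝ) 1 := by simp
  -- The term of order zero is absorbed in `eps`; the interval lengths cancel, and the noise
  -- contributes only `Sdot * w`.
  have e0 : S.eps i r₀ = (∫ _ in (S.rMin i ^ 2)..(S.rMax i ^ 2), (1 : ℝ)) - S.epsD i r₀ 0 := by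
    have := S.intervalIntegrable_inv_pow hcap r₀ h0
    simp only [sub_zero, one_mul] at this
    rw [eps, intervalIntegral.integral_sub intervalIntegrable_const this, epsD_eq]
    simp
  have e1 := intervalIntegral.integral_sub (μ := volume)
    (intervalIntegrable_const (a := S.rMin i ^ 2) (b := S.rMax i ^ 2) (c := (1 : ℝ)))
    (S.intervalIntegrable_inv_pow hcap r₀ hw)
  rw [e0, e1]
  convert h2.add h1 using 1
  · ext l
    rw [base]
    rcases l with _ | l
    · simp; ring
    · simp; ring
  · simp
    ring

end Params

section Mixed

variable {Ω : Type*} [MeasurableSpace Ω] {μ : Measure Ω} [IsProbabilityMeasure μ]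

theorem hasSum_exp_neg_mul_pow (y w : ℝ) :
    HasSum (fun k : ℕ => Real.exp (-y) * y ^ k / (k.factorial : ℝ) * w ^ k)
      (Real.exp (-((1 - w) * y))) := by
  have h := (NormedSpace.expSeries_div_hasSum_exp (y * w)).mul_left (Real.exp (-y))
  rw [← Real.exp_eq_exp_ℝ, ← Real.exp_add, show -y + y * w = -((1 - w) * y) by ring] at h
  refine h.congr_fun fun k => ?_
  rw [mul_pow]
  ring

/-- The coefficients are mixed Poisson probabilities. Sum and expectation commute because the
Poisson weights, with sum `1`, dominate. -/
theorem hasSum_integral_exp_neg_mul_pow {Y : Ω → ℝ} (hY : Measurable Y) (hY0 : ∀ᵐ ω ∂μ, 0 ≤ Y ω)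
    {w : ℝ} (hw : w ∈ Icc (0 : ℝ) 1) :
    HasSum (fun k : ℕ => (∫ ω, Real.exp (-Y ω) * Y ω ^ k / (k.factorial : ℝ) ∂μ) * w ^ k)
      (∫ ω, Real.exp (-((1 - w) * Y ω)) ∂μ) := by
  simp_rw [← integral_mul_const]
  have h1 : ∀ y : ℝ, HasSum (fun k : ℕ => Real.exp (-y) * y ^ k / (k.factorial : ℝ)) 1 := by
    intro y
    simpa using hasSum_exp_neg_mul_pow y 1
  refine hasSum_integral_of_dominated_convergence
    (fun k ω => Real.exp (-Y ω) * Y ω ^ k / (k.factorial : ℝ))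
    (fun k => Measurable.aestronglyMeasurable (by fun_prop)) (fun k => ?_)
    (ae_of_all _ fun ω => (h1 _).summable) ?_ (ae_of_all _ fun ω => hasSum_exp_neg_mul_pow _ _)
  · filter_upwards [hY0] with ω h
    rw [Real.norm_of_nonneg (mul_nonneg (by positivity) (pow_nonneg hw.1 k))]
    exact mul_le_of_le_one_right (by positivity) (pow_le_one₀ hw.1 hw.2)
  · simp_rw [(h1 _).tsum_eq]
    exact integrable_const 1

/-- The tail of a Gamma variable of integer shape at an independent random level. -/
theorem measureReal_lt_gamma {Y G : Ω → ℝ} (hY : Measurable Y) (hG : Measurable G)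
    (hYG : IndepFun G Y μ) (hY0 : ∀ᵐ ω ∂μ, 0 ≤ Y ω) {m : ℕ} (hm : 1 ≤ m) {r : ℝ} (hr : 0 < r)
    (hlaw : μ.map G = gammaMeasure m r) :
    μ.real {ω | Y ω < r * G ω} = ∑ k ∈ Finset.range m,
      ∫ ω, Real.exp (-Y ω) * Y ω ^ k / (k.factorial : ℝ) ∂μ := by
  have hF : Measurable (Function.uncurry fun y x : ℝ => {p : ℝ × ℝ | p.1 < r * p.2}.indicator
      (1 : ℝ × ℝ → ℝ) (y, x)) :=
    measurable_one.indicator (measurableSet_lt measurable_fst (by fun_prop))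
  have hms : MeasurableSet {ω | Y ω < r * G ω} := measurableSet_lt hY (by fun_prop)
  have hi : (fun ω => {p : ℝ × ℝ | p.1 < r * p.2}.indicator (1 : ℝ × ℝ → ℝ) (Y ω, G ω)) =
      {ω | Y ω < r * G ω}.indicator 1 := rfl
  have h := integral_of_indepFun hY hG hYG.symm hF
    (by rw [hi]; exact (integrable_const (1 : ℝ)).indicator hms)
  rw [← integral_indicator_one hms, ← hi, h, ← integral_finsetSum]
  · refine integral_congr_ae ?_
    filter_upwards [hY0] with ω hω
    have hms' : MeasurableSet {x : ℝ | Y ω < r * x} :=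
      measurableSet_lt measurable_const (by fun_prop)
    rw [← measureReal_gammaMeasure_Ioi hm hr hω, ← hlaw, measureReal_def,
      Measure.map_apply hG hms', ← measureReal_def, ← integral_indicator_one (hG hms')]
    rfl
  · intro k _
    refine Integrable.of_bound (C := 1) (Measurable.aestronglyMeasurable (by fun_prop)) ?_
    filter_upwards [hY0] with ω hω
    rw [Real.norm_of_nonneg (by positivity)]
    have h1 : HasSum (fun k : ℕ => Real.exp (-Y ω) * Y ω ^ k / (k.factorial : ℝ)) 1 := by
      simpa using hasSum_exp_neg_mul_pow (Y ω) 1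
    exact le_hasSum h1 k fun j _ => by positivity

end Mixed

end

/-! ### The SINR event, the Laplace transform of the level, and the success probability. -/

section


open Set Filter Topology

theorem measurable_sum_marked {f : Space → ℝ → ℝ} (hf : Measurable (Function.uncurry f)) :
    Measurable fun p : (ℕ × (ℕ → Space)) × (ℕ → ℝ) =>
      ∑ k ∈ Finset.range p.1.1, f (p.1.2 k) (p.2 k) := by
  have : Measurable (Function.uncurry fun (n : ℕ) (q : (ℕ → Space) × (ℕ → ℝ)) =>
      ∑ k ∈ Finset.range n, f (q.1 k) (q.2 k)) :=
    measurable_from_prod_countable_right fun n =>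
      Finset.measurable_fun_sum (Finset.range n) fun k _ =>
        hf.comp (f := fun q : (ℕ → Space) × (ℕ → ℝ) => (q.1 k, q.2 k)) (by fun_prop)
  exact this.comp ((measurable_fst.comp measurable_fst).prodMk
    ((measurable_snd.comp measurable_fst).prodMk measurable_snd))

theorem measurable_shift : Measurable fun (g : ℕ → ℝ) (k : ℕ) => g (k + 1) :=
  measurable_pi_lambda _ fun k => measurable_pi_apply (k + 1)

namespace Params

variable (S : Params)

/-- Received interference power, relative to the received power of the link of length `r₀` and in
units of the threshold. -/
noncomputable def weight (i : Hop) (u : Space) (r₀ : ℝ) (x : Space) : ℝ :=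
  S.theta i * r₀ ^ 2 / dist x (S.receiver i u) ^ 2

/-- The level that the normalized channel gain of the link has to exceed. -/
noncomputable def level (i : Hop) (u : Space) (r₀ : ℝ) (n : ℕ) (x : ℕ → Space) (g : ℕ → ℝ) : ℝ :=
  (∑ k ∈ Finset.range n, S.m i / S.spread i * (S.weight i u r₀ (x k) * g k)) + S.Sdot i r₀

theorem weight_nonneg (i : Hop) (u : Space) (r₀ : ℝ) (x : Space) : 0 ≤ S.weight i u r₀ x :=
  S.ratio_nonneg i r₀ (sq_nonneg _)

theorem measurable_weight (i : Hop) (u : Space) (r₀ : ℝ) : Measurable (S.weight i u r₀) := by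
  unfold weight
  fun_prop

theorem Sdot_nonneg (i : Hop) (r₀ : ℝ) : 0 ≤ S.Sdot i r₀ := by
  have := S.theta_pos i
  have := S.spread_pos i
  have := S.P_pos i
  have := S.iota_pos i
  have := S.loss_pos i
  unfold Sdot
  positivity

theorem rate_pos (i : Hop) : 0 < (S.m i : ℝ) / S.spread i :=
  div_pos (by exact_mod_cast S.m_pos i) (S.spread_pos i)

theorem measurable_level (i : Hop) (u : Space) (r₀ : ℝ) :
    Measurable fun p : (ℕ × (ℕ → Space)) × (ℕ → ℝ) => S.level i u r₀ p.1.1 p.1.2 p.2 := by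
  have h := measurable_sum_marked
    (f := fun x h => S.m i / S.spread i * (S.weight i u r₀ x * h))
    ((((S.measurable_weight i u r₀).comp measurable_fst).mul measurable_snd).const_mul _)
  exact h.add_const _

theorem level_nonneg (i : Hop) (u : Space) (r₀ : ℝ) (n : ℕ) (x : ℕ → Space) {g : ℕ → ℝ}
    (hg : ∀ k, 0 ≤ g k) : 0 ≤ S.level i u r₀ n x g :=
  add_nonneg (Finset.sum_nonneg fun k _ => mul_nonneg (S.rate_pos i).le
    (mul_nonneg (S.weight_nonneg i u r₀ _) (hg k))) (S.Sdot_nonneg i r₀)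

theorem theta_lt_sinr_iff (i : Hop) (u t₀ : Space) (h₀ : 0 < dist t₀ (S.receiver i u)) (n : ℕ)
    (x : ℕ → Space) {g : ℕ → ℝ} (hg : ∀ k, 0 ≤ g k) :
    S.theta i < S.sinr i u t₀ n x g ↔
      S.level i u (dist t₀ (S.receiver i u)) n x (fun k => g (k + 1)) <
        S.m i / S.spread i * g 0 := by
  have hc := S.c_pos
  have hP := S.P_pos i
  have hio := S.iota_pos i
  have hD := S.D_pos i
  have hf := S.f_pos i
  have hl := S.loss_pos i
  have hth := S.theta_pos i
  have hsp := S.spread_pos i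
  have hsg := S.sigma_pos i
  have hm : (0 : ℝ) < S.m i := by exact_mod_cast S.m_pos i
  have hpi := Real.pi_pos
  set r₀ := dist t₀ (S.receiver i u)
  -- In gain times path loss, `(π D f / c)² (c / (4 π f))² = D² / 16`; hence the `16` in `Sdot`.
  set A : ℝ := S.P i * (S.iota i * S.loss i * S.D i ^ 2 / 16) with hA
  have hApos : 0 < A := by positivity
  have hrx : ∀ (t : Space) (h : ℝ), S.rxPower i u t h =
      A * (h * (dist t (S.receiver i u) ^ 2)⁻¹) := by
    intro t h
    rw [rxPower, gain, pathLoss, hA]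
    field_simp
    ring
  have hI : 0 ≤ ∑ k ∈ Finset.range n, S.rxPower i u (x k) (g (k + 1)) :=
    Finset.sum_nonneg fun k _ => by
      have := hg (k + 1)
      rw [hrx]
      positivity
  have hden : 0 < (∑ k ∈ Finset.range n, S.rxPower i u (x k) (g (k + 1))) + S.sigma i ^ 2 := by
    positivity
  have hfac : 0 < A * S.spread i / (S.m i * r₀ ^ 2) := by positivity
  have e1 : S.rxPower i u t₀ (g 0) =
      A * S.spread i / (S.m i * r₀ ^ 2) * (S.m i / S.spread i * g 0) := by
    rw [hrx]
    change A * (g 0 * (r₀ ^ 2)⁻¹) = _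
    field_simp
  have e2 : S.theta i *
      ((∑ k ∈ Finset.range n, S.rxPower i u (x k) (g (k + 1))) + S.sigma i ^ 2) =
      A * S.spread i / (S.m i * r₀ ^ 2) * S.level i u r₀ n x (fun k => g (k + 1)) := by
    rw [level, mul_add, mul_add, Finset.mul_sum, Finset.mul_sum]
    congr 1
    · refine Finset.sum_congr rfl fun k _ => ?_
      rw [hrx, weight]
      field_simp
    · rw [Sdot, hA]
      field_simp
  rw [sinr, lt_div_iff₀ hden, e1, e2, mul_lt_mul_iff_right₀ hfac]

theorem measurable_sinr (i : Hop) (u : Space) :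
    Measurable fun p : Space × (ℕ × (ℕ → Space)) × (ℕ → ℝ) =>
      S.sinr i u p.1 p.2.1.1 p.2.1.2 p.2.2 := by
  have hrx : Measurable (Function.uncurry fun (x : Space) (h : ℝ) => S.rxPower i u x h) := by
    unfold rxPower pathLoss
    fun_prop
  have h := (measurable_sum_marked hrx).comp
    (f := fun p : Space × (ℕ × (ℕ → Space)) × (ℕ → ℝ) => (p.2.1, fun k => p.2.2 (k + 1)))
    (by fun_prop)
  have h0 : Measurable fun p : Space × (ℕ × (ℕ → Space)) × (ℕ → ℝ) =>
      S.rxPower i u p.1 (p.2.2 0) :=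
    hrx.comp (measurable_fst.prodMk
      ((measurable_pi_apply 0).comp (measurable_snd.comp measurable_snd)))
  exact h0.div (h.add_const _)

end Params

namespace IsLinkModel

variable {S : Params} {i : Hop} {u : Space} {Ω : Type*} [MeasurableSpace Ω] {μ : Measure Ω}
  {T : Ω → Space} {N : Ω → ℕ} {X : ℕ → Ω → Space} {g : ℕ → Ω → ℝ}

theorem ae_gain_nonneg (h : IsLinkModel S i u μ T N X g) : ∀ᵐ ω ∂μ, ∀ n, 0 ≤ g n ω := by
  refine ae_all_iff.2 fun n => ?_
  have := ae_nonneg_gammaMeasure (m := S.m i) (r := S.m i / S.spread i)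
  rw [← h.law_gain n] at this
  exact ae_of_ae_map (h.measurable_gain n).aemeasurable this

theorem measurable_location (h : IsLinkModel S i u μ T N X g) :
    Measurable fun ω => (N ω, fun n => X n ω) :=
  h.poisson.measurable_card.prodMk (measurable_pi_lambda _ h.poisson.measurable_point)

theorem measurable_gains (h : IsLinkModel S i u μ T N X g) : Measurable fun ω n => g n ω :=
  measurable_pi_lambda _ h.measurable_gain

theorem measurable_level (h : IsLinkModel S i u μ T N X g) (r₀ : ℝ) :
    Measurable fun ω => S.level i u r₀ (N ω) (fun n => X n ω) (fun k => g (k + 1) ω) :=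
  (S.measurable_level i u r₀).comp (f := fun ω => ((N ω, fun n => X n ω), fun k => g (k + 1) ω))
    (h.measurable_location.prodMk
      (measurable_pi_lambda _ fun k => h.measurable_gain (k + 1)))

theorem integral_exp_neg_fading [IsProbabilityMeasure μ] (h : IsLinkModel S i u μ T N X g) {z : ℝ}
    (hz : 0 ≤ z) (b : ℕ → ℝ) (hb : ∀ k, 0 ≤ b k) (n : ℕ) :
    ∫ ω, Real.exp (-(z * ∑ k ∈ Finset.range n, S.m i / S.spread i * (b k * g (k + 1) ω))) ∂μ =
      ∏ k ∈ Finset.range n, ((1 + z * b k) ^ S.m i)⁻¹ := by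
  have hind := h.indep_gain.precomp (g := fun k : Fin n => (k : ℕ) + 1)
    (fun a b hab => Fin.ext (by simpa using hab))
  have hprod := hind.integral_fun_prod_comp (𝕜 := ℝ)
    (f := fun (k : Fin n) x => Real.exp (-(z * b k * (S.m i / S.spread i) * x)))
    (fun k => (h.measurable_gain _).aemeasurable)
    (fun k => Measurable.aestronglyMeasurable (by fun_prop))
  have e : ∀ ω, Real.exp (-(z * ∑ k ∈ Finset.range n, S.m i / S.spread i * (b k * g (k + 1) ω))) =
      ∏ k : Fin n, Real.exp (-(z * b k * (S.m i / S.spread i) * g ((k : ℕ) + 1) ω)) := by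
    intro ω
    rw [← Real.exp_sum, Finset.sum_range, Finset.mul_sum, Finset.sum_neg_distrib]
    congr 2
    exact Finset.sum_congr rfl fun k _ => by ring
  simp_rw [e]
  rw [hprod, Finset.prod_range]
  refine Finset.prod_congr rfl fun k _ => ?_
  have hl := integral_exp_neg_gammaMeasure (S.m_pos i) (S.rate_pos i) (mul_nonneg hz (hb k))
  rw [← h.law_gain ((k : ℕ) + 1), integral_map (h.measurable_gain _).aemeasurable
    (Measurable.aestronglyMeasurable (by fun_prop))] at hl
  exact hl

/-- With the locations frozen, the gains give a product of Gamma Laplace transforms. Its mean over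
the locations is a Poisson generating functional, whose integrand depends on the squared distance
only. -/
theorem integral_exp_neg_level [IsProbabilityMeasure μ] (h : IsLinkModel S i u μ T N X g)
    (hcap : S.CapFits i) (hu : ‖u‖ = 1) (r₀ : ℝ) {z : ℝ} (hz : 0 ≤ z) :
    ∫ ω, Real.exp (-(z * S.level i u r₀ (N ω) (fun n => X n ω) (fun k => g (k + 1) ω))) ∂μ =
      Real.exp (-(z * S.Sdot i r₀ + S.Rdot i * ∫ y in (S.rMin i ^ 2)..(S.rMax i ^ 2),
        (1 - ((1 + z * (S.theta i * r₀ ^ 2 / y)) ^ S.m i)⁻¹))) := by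
  have hind : IndepFun (fun ω => (N ω, fun n => X n ω)) (fun ω n => g n ω) μ :=
    h.indep_fading.comp measurable_snd measurable_id
  have hF : Measurable (Function.uncurry fun (p : ℕ × (ℕ → Space)) (g : ℕ → ℝ) =>
      Real.exp (-(z * S.level i u r₀ p.1 p.2 (fun k => g (k + 1))))) := by
    have := (S.measurable_level i u r₀).comp
      (f := fun q : (ℕ × (ℕ → Space)) × (ℕ → ℝ) => (q.1, fun k => q.2 (k + 1)))
      (measurable_fst.prodMk (measurable_shift.comp measurable_snd))
    exact (this.const_mul z).neg.exp
  have hm : Measurable fun ω =>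
      Real.exp (-(z * S.level i u r₀ (N ω) (fun n => X n ω) (fun k => g (k + 1) ω))) :=
    ((h.measurable_level r₀).const_mul z).neg.exp
  rw [integral_of_indepFun h.measurable_location h.measurable_gains hind hF]
  · have e : ∀ ω, ∫ ω', Real.exp (-(z * S.level i u r₀ (N ω) (fun n => X n ω)
        (fun k => g (k + 1) ω'))) ∂μ = Real.exp (-(z * S.Sdot i r₀)) *
        ∏ k ∈ Finset.range (N ω), ((1 + z * S.weight i u r₀ (X k ω)) ^ S.m i)⁻¹ := by
      intro ω
      rw [← h.integral_exp_neg_fading hz (fun k => S.weight i u r₀ (X k ω))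
        (fun k => S.weight_nonneg i u r₀ _), ← integral_const_mul]
      refine integral_congr_ae (ae_of_all _ fun ω' => ?_)
      simp only [Params.level]
      rw [← Real.exp_add]
      congr 1
      ring
    simp_rw [e]
    have hw := S.weight_nonneg i u r₀
    rw [integral_const_mul, h.poisson.integral_prod
      (φ := fun x => ((1 + z * S.weight i u r₀ x) ^ S.m i)⁻¹)
      ((((S.measurable_weight i u r₀).const_mul z).const_add 1).pow_const _).inv (fun x => by
        have := mul_nonneg hz (hw x)
        exact ⟨by positivity, inv_le_one_of_one_le₀ (one_le_pow₀ (by linarith))⟩),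
      ← Real.exp_add, neg_add]
    congr 3
    exact S.integral_intensity hcap hu
      (F := fun y => 1 - ((1 + z * (S.theta i * r₀ ^ 2 / y)) ^ S.m i)⁻¹) (by fun_prop)
  · refine Integrable.of_bound (C := 1) hm.aestronglyMeasurable ?_
    filter_upwards [h.ae_gain_nonneg] with ω hω
    rw [Real.norm_of_nonneg (Real.exp_nonneg _), Real.exp_le_one_iff]
    have := S.level_nonneg i u r₀ (N ω) (fun n => X n ω) (fun k => hω (k + 1))
    have := mul_nonneg hz this
    linarith

theorem dist_pos (hu : ‖u‖ = 1) {t₀ : Space} (ht : t₀ ∈ S.coverage i u) :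
    0 < dist t₀ (S.receiver i u) :=
  (S.rMin_pos i).trans_le (S.rMin_le_dist hu ht)

theorem measureReal_sinr [IsProbabilityMeasure μ] (h : IsLinkModel S i u μ T N X g)
    (hcap : S.CapFits i) (hu : ‖u‖ = 1) {t₀ : Space} (ht : t₀ ∈ S.coverage i u) :
    μ.real {ω | S.theta i < S.sinr i u t₀ (N ω) (fun n => X n ω) (fun n => g n ω)} =
      S.successProb i (dist t₀ (S.receiver i u)) := by
  set r₀ := dist t₀ (S.receiver i u)
  set Y : Ω → ℝ := fun ω => S.level i u r₀ (N ω) (fun n => X n ω) (fun k => g (k + 1) ω)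
  have hshift : Measurable fun ω k => g (k + 1) ω :=
    measurable_pi_lambda _ fun k => h.measurable_gain (k + 1)
  have hY : Measurable Y := h.measurable_level r₀
  have hY0 : ∀ᵐ ω ∂μ, 0 ≤ Y ω := by
    filter_upwards [h.ae_gain_nonneg] with ω hω
    exact S.level_nonneg i u r₀ _ _ fun k => hω (k + 1)
  -- The gain of the link is independent of the other gains, and all gains together of the
  -- locations; `Y` is a function of the other gains and the locations.
  have hind : IndepFun (g 0) Y μ := by
    have h1 : IndepFun (fun ω => (g 0 ω, fun k => g (k + 1) ω)) (fun ω => (N ω, fun n => X n ω)) μ :=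
      (h.indep_fading.comp measurable_snd
        (((measurable_pi_apply 0).prodMk measurable_shift))).symm
    have h2 := indepFun_prodMk_right (h.measurable_gain 0) hshift h.measurable_location
      (indepFun_zero_succ h.measurable_gain h.indep_gain) h1
    exact h2.comp (φ := id)
      (ψ := fun p : (ℕ → ℝ) × (ℕ × (ℕ → Space)) => S.level i u r₀ p.2.1 p.2.2 p.1)
      measurable_id ((S.measurable_level i u r₀).comp (f := Prod.swap) measurable_swap)
  have hevent : {ω | S.theta i < S.sinr i u t₀ (N ω) (fun n => X n ω) (fun n => g n ω)} =ᵐ[μ]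
      {ω | Y ω < S.m i / S.spread i * g 0 ω} := by
    filter_upwards [h.ae_gain_nonneg] with ω hω
    exact propext (S.theta_lt_sinr_iff i u t₀ (dist_pos hu ht) _ _ hω)
  have hp := fun (w : ℝ) (hw : w ∈ Icc (0 : ℝ) 1) => hasSum_integral_exp_neg_mul_pow hY hY0 hw
  have h1 : (1 : ℝ) ∈ Icc (0 : ℝ) 1 := by simp
  have hps : Summable fun k : ℕ => |∫ ω, Real.exp (-Y ω) * Y ω ^ k / (k.factorial : ℝ) ∂μ| := by
    simpa using (hp 1 h1).summable.abs
  have hbs : Summable fun l : ℕ => |S.base i r₀ (l + 1)| := by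
    simpa using (S.hasSum_base hcap r₀ h1).summable.abs
  -- `K` is the value of the generating function at `w = 0`, that is, the Laplace transform at `1`.
  have hcoeff := exp_series_coeff (K := Real.exp (-S.Sdot i r₀ - S.Rdot i * S.eps i r₀)) hps hbs
    (fun w hw => by
      rw [(S.hasSum_base hcap r₀ hw).tsum_eq, ← Real.exp_add]
      convert hp w hw using 1
      rw [h.integral_exp_neg_level hcap hu r₀ (sub_nonneg.2 hw.2)]
      congr 1
      ring)
  rw [measureReal_congr hevent,
    measureReal_lt_gamma hY (h.measurable_gain 0) hind hY0 (S.m_pos i) (S.rate_pos i) (h.law_gain 0),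
    Params.successProb, Finset.mul_sum]
  exact Finset.sum_congr rfl fun k _ => hcoeff k

/-- `T` is independent of the locations and gains jointly, so integrating these out with `T` frozen
gives the conditional probability; on the coverage region the fixed-location formula evaluates it.
-/
theorem condExp_sinr [IsProbabilityMeasure μ] (h : IsLinkModel S i u μ T N X g)
    (hcap : S.CapFits i) (hu : ‖u‖ = 1) :
    μ⟦{ω | S.theta i < S.sinr i u (T ω) (N ω) (fun n => X n ω) (fun n => g n ω)} |
        MeasurableSpace.comap T inferInstance⟧
      =ᵐ[μ] fun ω => S.successProb i (dist (T ω) (S.receiver i u)) := by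
  set V : Ω → (ℕ × (ℕ → Space)) × (ℕ → ℝ) := fun ω => ((N ω, fun n => X n ω), fun n => g n ω)
  have hV : Measurable V := h.measurable_location.prodMk h.measurable_gains
  have hTV : IndepFun T V μ := indepFun_prodMk_right h.measurable_tx h.measurable_location
    h.measurable_gains h.indep_location h.indep_fading
  set E : Set (Space × (ℕ × (ℕ → Space)) × (ℕ → ℝ)) :=
    {p | S.theta i < S.sinr i u p.1 p.2.1.1 p.2.1.2 p.2.2}
  have hE : MeasurableSet E := measurableSet_lt measurable_const (S.measurable_sinr i u)
  set A : Set Ω := {ω | S.theta i < S.sinr i u (T ω) (N ω) (fun n => X n ω) (fun n => g n ω)}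
  have hA : MeasurableSet A := hE.preimage (h.measurable_tx.prodMk hV)
  -- `q` is measurable as a parameter integral, so measurability of `successProb` is not needed; the
  -- two agree along `T` almost surely.
  set q : Space → ℝ := fun t => ∫ ω, E.indicator (fun _ => (1 : ℝ)) (t, V ω) ∂μ
  have hEm : Measurable (E.indicator (fun _ => (1 : ℝ))) := measurable_const.indicator hE
  have hq : Measurable q :=
    (StronglyMeasurable.integral_prod_right (f := fun t ω => E.indicator (fun _ => (1 : ℝ)) (t, V ω))
      (hEm.comp (measurable_fst.prodMk (hV.comp measurable_snd))).stronglyMeasurable).measurable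
  have hqs : (fun ω => q (T ω)) =ᵐ[μ] fun ω => S.successProb i (dist (T ω) (S.receiver i u)) := by
    filter_upwards [h.tx_mem] with ω hω
    have hE' : MeasurableSet {ω' | S.theta i < S.sinr i u (T ω) (N ω') (fun n => X n ω')
        (fun n => g n ω')} := hE.preimage (measurable_const.prodMk hV)
    rw [← h.measureReal_sinr hcap hu hω, ← integral_indicator_one hE']
    rfl
  have hq1 : ∀ t, ‖q t‖ ≤ 1 := by
    intro t
    refine (norm_integral_le_of_norm_le_const (C := 1) (ae_of_all _ fun ω => ?_)).trans (by simp)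
    by_cases hp : (t, V ω) ∈ E <;> simp [hp]
  have hqint : Integrable (fun ω => q (T ω)) μ :=
    Integrable.of_bound (hq.comp h.measurable_tx).aestronglyMeasurable 1 (ae_of_all _ fun ω => hq1 _)
  refine EventuallyEq.trans (EventuallyEq.symm ?_) hqs
  refine ae_eq_condExp_of_forall_setIntegral_eq h.measurable_tx.comap_le
    ((integrable_const (1 : ℝ)).indicator hA) (fun s _ _ => hqint.integrableOn) ?_
    (hq.comp (comap_measurable T)).aestronglyMeasurable
  rintro s ⟨B, hB, rfl⟩ -
  have hF : Measurable (Function.uncurry fun t v => B.indicator (1 : Space → ℝ) t *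
      E.indicator (fun _ => (1 : ℝ)) (t, v)) :=
    ((measurable_one.indicator hB).comp measurable_fst).mul hEm
  have hBm := h.measurable_tx hB
  have e1 : (fun ω => B.indicator (1 : Space → ℝ) (T ω) * E.indicator (fun _ => (1 : ℝ)) (T ω, V ω)) =
      (T ⁻¹' B).indicator (A.indicator fun _ => (1 : ℝ)) := by
    ext ω
    by_cases hb : T ω ∈ B <;> by_cases ha : (T ω, V ω) ∈ E
    · have : ω ∈ A := ha
      simp [hb, ha, this]
    · have : ω ∉ A := ha
      simp [hb, ha, this]
    · simp [hb]
    · simp [hb]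
  have key := integral_of_indepFun h.measurable_tx hV hTV hF
    (by rw [e1]; exact ((integrable_const (1 : ℝ)).indicator hA).indicator hBm)
  rw [← integral_indicator hBm, ← integral_indicator hBm, ← e1, key]
  refine integral_congr_ae (ae_of_all _ fun ω => ?_)
  simp only [integral_const_mul]
  by_cases hb : T ω ∈ B <;> simp [hb, q]

end IsLinkModel

end

end GASS

theorem proposition1 (S : GASS.Params) (i : GASS.Hop) (hcap : S.CapFits i)
    (u : GASS.Space) (hu : ‖u‖ = 1)
    {Ω : Type*} [MeasurableSpace Ω] (μ : Measure Ω) [IsProbabilityMeasure μ]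
    (T : Ω → GASS.Space) (N : Ω → ℕ) (X : ℕ → Ω → GASS.Space) (g : ℕ → Ω → ℝ)
    (hmodel : GASS.IsLinkModel S i u μ T N X g) :
    (∀ t₀ ∈ S.coverage i u,
      μ.real {ω | S.theta i < S.sinr i u t₀ (N ω) (fun n => X n ω) (fun n => g n ω)} =
        S.successProb i (dist t₀ (S.receiver i u))) ∧
    μ⟦{ω | S.theta i < S.sinr i u (T ω) (N ω) (fun n => X n ω) (fun n => g n ω)} |
        MeasurableSpace.comap T inferInstance⟧
      =ᵐ[μ] fun ω => S.successProb i (dist (T ω) (S.receiver i u)) :=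
  ⟨fun _ ht => hmodel.measureReal_sinr hcap hu ht, hmodel.condExp_sinr hcap hu⟩
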